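/- For a finite simple graph $G=(V,E)$ and a set $A\subseteq V$ of initially active vertices, the strict majority bootstrap percolation process is the following: in each round, every passive vertex $v$ that has at least $\lceil(\deg(v)+1)/2\rceil$ active neighbours becomes active, and active vertices remain active forever. The set $A$ percolates $G$ if eventually all vertices of $G$ are active. Let $\mathbb{P}_p$ denote the law under which each vertex belongs to $A$ independently with probability $p$. For a family $\mathcal{G}=(G_n)_n$ of finite graphs put $$p^+_c(\mathcal{G})=\inf\Bigl\{p\in[0,1] : \liminf_{n\to\infty}\mathbb{P}_p\bigl(A \text{ percolates } G_n\bigr)=1\Bigr\}.$$ For $n,r\in\mathbb{N}$ let $C_n(r)$ be the ring on the vertices $0,1,\dots,n-1$ in which distinct vertices $i,j$ are adjacent if and only if $j\equiv i+d$ or $j\equiv i-d \pmod n$ for some $1\le d\le r$, and let the $r$-wheel $\mathrm{WH}_n(r)$ be the graph obtained from $C_n(r)$ by adding one new vertex adjacent to all vertices of $C_n(r)$. Let $\mathcal{WH}(r)=(\mathrm{WH}_n(r))_n$. Then the limit of $p^+_c(\mathcal{WH}(r))$ as $r\to\infty$ exists and $$\lim_{r\to\infty}p^+_c(\mathcal{WH}(r))=\frac14.$$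 -/

import Mathlib

noncomputable section

namespace StrictMBP

open Filter MeasureTheory ProbabilityTheory

section Dynamics

variable {V : Type*} [Fintype V]

open Classical in
/-- The number of neighbours of `v` in `G` that belong to the set `A` of active vertices. -/
def activeNeighbors (G : SimpleGraph V) (A : Set V) (v : V) : ℕ :=
  ((G.neighborFinset v).filter (fun w => w ∈ A)).card

open Classical in
/-- The strict majority threshold `⌈(deg v + 1) / 2⌉` of a vertex. -/
def threshold (G : SimpleGraph V) (v : V) : ℕ :=
  ⌈((G.degree v : ℚ) + 1) / 2⌉₊

/-- One round of strict majority bootstrap percolation: active vertices stay active, and a passive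
vertex becomes active iff the number of its active neighbours is at least its threshold. -/
def step (G : SimpleGraph V) (A : Set V) : Set V :=
  A ∪ {v | threshold G v ≤ activeNeighbors G A v}

/-- The initial set `A` of active vertices percolates: at the end of the process
all vertices are active. -/
def Percolates (G : SimpleGraph V) (A : Set V) : Prop :=
  ∃ t : ℕ, (step G)^[t] A = Set.univ

/-- The probability that `A` percolates `G`, when each vertex is put into `A`
independently with probability `p`. -/
def percolationProb (G : SimpleGraph V) (p : unitInterval) : ENNReal :=
  setBernoulli (Set.univ : Set V) p {A | Percolates G A}

end Dynamics

/-- The critical probability `p_c^+` of a family `(G_n)_n` of finite graphs: the infimum of the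
`p ∈ [0,1]` for which the liminf, as `n → ∞`, of the percolation probability equals `1`. -/
def criticalProb {V : ℕ → Type*} [∀ n, Fintype (V n)] (G : ∀ n, SimpleGraph (V n)) : ℝ :=
  sInf {p : ℝ | ∃ hp : p ∈ unitInterval,
    liminf (fun n : ℕ => percolationProb (G n) ⟨p, hp⟩) atTop = 1}

/-- The ring `C_n(r)` on `0, …, n-1`: each vertex is joined to its `r` closest vertices on each
side, i.e. distinct `i`, `j` are adjacent iff one is `d` steps after the other on the ring
(modulo `n`) for some `1 ≤ d ≤ r`. -/
def ring (n r : ℕ) : SimpleGraph (Fin n) :=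
  SimpleGraph.fromRel (fun i j => ∃ d : ℕ, 1 ≤ d ∧ d ≤ r ∧ (j : ℕ) = ((i : ℕ) + d) % n)

/-- The graph `u * G`: the graph `G` augmented with one universal vertex `u = none`, which is
adjacent to all vertices of `G`. -/
def addUniversal {V : Type*} (G : SimpleGraph V) : SimpleGraph (Option V) :=
  SimpleGraph.fromRel (fun x y => x = none ∨ ∃ v w, x = some v ∧ y = some w ∧ G.Adj v w)

/-- The `r`-wheel `WH_n(r) = u * C_n(r)`. -/
def wheel (n r : ℕ) : SimpleGraph (Option (Fin n)) :=
  addUniversal (ring n r)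

end StrictMBP

end

noncomputable section

namespace StrictMBP

open Filter MeasureTheory ProbabilityTheory

/-- The law of a random set of natural numbers containing each number independently with
probability `p`. -/
abbrev bern (p : unitInterval) : Measure (Set ℕ) := setBernoulli (Set.univ : Set ℕ) p

theorem measurable_preimage {V : Type*} (f : V → ℕ) :
    Measurable (fun B : Set ℕ => f ⁻¹' B) := by
  refine measurable_set_iff.2 fun i => ?_
  simp only [Set.mem_preimage]
  fun_prop

/-- Sampling the vertices of a countable set is the same as sampling all natural numbers and
pulling back along an injection. -/
theorem setBernoulli_univ_eq_map {V : Type} {f : V → ℕ} (hf : Function.Injective f)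
    (p : unitInterval) :
    setBernoulli (Set.univ : Set V) p = (bern p).map (fun B => f ⁻¹' B) := by
  let ν : Measure Prop := unitInterval.toNNReal p • Measure.dirac True +
    unitInterval.toNNReal (unitInterval.symm p) • Measure.dirac False
  have hν (W : Type) : (fun i : W => unitInterval.toNNReal p • Measure.dirac (i ∈ Set.univ) +
      unitInterval.toNNReal (unitInterval.symm p) • Measure.dirac False) = fun _ => ν := by
    ext i : 1
    simp [ν]
  have hν1 : IsProbabilityMeasure ν := by
    refine ⟨?_⟩
    simp [ν]
  have hm (W : Type) : Measurable (fun P : W → Prop => {i | P i}) :=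
    MeasurableEquiv.setOfPred.measurable
  rw [bern, setBernoulli_eq_map, setBernoulli_eq_map, hν, hν,
    ← Measure.map_infinitePi_infinitePi_of_inj (P := fun _ : ℕ => ν) hf,
    Measure.map_map (hm V) (by fun_prop), Measure.map_map (measurable_preimage f) (hm ℕ)]
  rfl

/-- Membership of `A` in the event `E` depends only on the trace of `A` on `S`. -/
def DeterminedOn (E : Set (Set ℕ)) (S : Finset ℕ) : Prop :=
  ∀ A B : Set ℕ, (∀ i ∈ S, i ∈ A ↔ i ∈ B) → A ∈ E → B ∈ E

theorem iIndepFun_mem (p : unitInterval) :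
    iIndepFun (fun (i : ℕ) (A : Set ℕ) => i ∈ A) (bern p) := by
  rw [iIndepFun_iff_measure_inter_preimage_eq_mul]
  intro S s hs
  simp_rw [bern, setBernoulli_apply']
  exact (iIndepFun_infinitePi (X := fun _ x => x) (fun _ => measurable_id)
    ).measure_inter_preimage_eq_mul S hs

theorem DeterminedOn.exists_preimage {E : Set (Set ℕ)} {S : Finset ℕ} (h : DeterminedOn E S) :
    ∃ E' : Set (S → Prop), E = (fun A (i : S) => (i : ℕ) ∈ A) ⁻¹' E' := by
  refine ⟨(fun A (i : S) => (i : ℕ) ∈ A) '' E, ?_⟩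
  ext A
  simp only [Set.mem_preimage, Set.mem_image]
  constructor
  · intro hA
    exact ⟨A, hA, rfl⟩
  · rintro ⟨B, hB, hBA⟩
    refine h B A (fun i hi => ?_) hB
    have := congrFun hBA ⟨i, hi⟩
    simpa using this

theorem measurable_trace (S : Finset ℕ) :
    Measurable (fun (A : Set ℕ) (i : S) => (i : ℕ) ∈ A) := by
  rw [measurable_pi_iff]
  intro i
  fun_prop

theorem DeterminedOn.measurableSet {E : Set (Set ℕ)} {S : Finset ℕ} (h : DeterminedOn E S) :
    MeasurableSet E := by
  obtain ⟨E', rfl⟩ := h.exists_preimage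
  exact measurable_trace S (Set.toFinite E').measurableSet

theorem DeterminedOn.inter_eq_mul {E F : Set (Set ℕ)} {S T : Finset ℕ} (hE : DeterminedOn E S)
    (hF : DeterminedOn F T) (hST : Disjoint S T) (p : unitInterval) :
    (bern p).real (E ∩ F) = (bern p).real E * (bern p).real F := by
  obtain ⟨E', rfl⟩ := hE.exists_preimage
  obtain ⟨F', rfl⟩ := hF.exists_preimage
  have := (iIndepFun_mem p).indepFun_finset S T hST (fun i => by fun_prop)
  rw [measureReal_def, this.measure_inter_preimage_eq_mul _ _ (Set.toFinite E').measurableSet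
    (Set.toFinite F').measurableSet, ENNReal.toReal_mul]
  rfl

theorem DeterminedOn.mono {E : Set (Set ℕ)} {S T : Finset ℕ} (hE : DeterminedOn E S)
    (hST : S ⊆ T) : DeterminedOn E T :=
  fun A B hAB => hE A B (fun i hi => hAB i (hST hi))

theorem DeterminedOn.compl {E : Set (Set ℕ)} {S : Finset ℕ} (hE : DeterminedOn E S) :
    DeterminedOn Eᶜ S :=
  fun A B hAB hA hB => hA (hE B A (fun i hi => (hAB i hi).symm) hB)

theorem DeterminedOn.biInter {ι : Type*} {J : Finset ι} {E : ι → Set (Set ℕ)} {S : ι → Finset ℕ}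
    (hE : ∀ j ∈ J, DeterminedOn (E j) (S j)) :
    DeterminedOn (⋂ j ∈ J, E j) (J.biUnion S) := by
  intro A B hAB hA
  simp only [Set.mem_iInter] at hA ⊢
  exact fun j hj => hE j hj A B (fun i hi => hAB i (Finset.mem_biUnion.2 ⟨j, hj, hi⟩)) (hA j hj)

theorem real_biInter_eq_prod {ι : Type*} (J : Finset ι) {E : ι → Set (Set ℕ)}
    {S : ι → Finset ℕ} (hE : ∀ j ∈ J, DeterminedOn (E j) (S j))
    (hS : (J : Set ι).PairwiseDisjoint S) (p : unitInterval) :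
    (bern p).real (⋂ j ∈ J, E j) = ∏ j ∈ J, (bern p).real (E j) := by
  classical
  induction J using Finset.induction_on with
  | empty => simp
  | insert a J ha ih =>
    rw [Finset.set_biInter_insert, Finset.prod_insert ha,
      ← ih (fun j hj => hE j (Finset.mem_insert_of_mem hj))
        (hS.subset (by simp))]
    refine (hE a (Finset.mem_insert_self a J)).inter_eq_mul
      (DeterminedOn.biInter fun j hj => hE j (Finset.mem_insert_of_mem hj)) ?_ p
    rw [Finset.disjoint_biUnion_right]
    intro j hj
    exact hS (by simp) (by simp [hj]) (by rintro rfl; exact ha hj)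

theorem real_mem (p : unitInterval) (i : ℕ) : (bern p).real {A | i ∈ A} = p := by
  have hf : Function.Injective (fun _ : Unit => i) := fun _ _ _ => rfl
  have h := setBernoulli_real_singleton (u := (Set.univ : Set Unit)) (s := Set.univ) p
    (Set.subset_univ _) (Set.toFinite _)
  rw [setBernoulli_univ_eq_map hf, map_measureReal_apply (measurable_preimage _)
    (Set.toFinite _).measurableSet] at h
  have h2 : (fun B : Set ℕ => (fun _ : Unit => i) ⁻¹' B) ⁻¹' {Set.univ} = {A | i ∈ A} := by
    ext A
    simp [Set.eq_univ_iff_forall]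
  rw [h2] at h
  simpa using h

theorem determinedOn_mem_iff (i : ℕ) (P : Prop) :
    DeterminedOn {A | i ∈ A ↔ P} {i} := by
  intro A B hAB hA
  have := hAB i (by simp)
  exact this.symm.trans hA

open Classical in
theorem real_trace_eq (p : unitInterval) {S T : Finset ℕ} (hT : T ⊆ S) :
    (bern p).real {A | ∀ i ∈ S, i ∈ A ↔ i ∈ T} =
      (p : ℝ) ^ T.card * (1 - p : ℝ) ^ (S.card - T.card) := by
  have h1 : {A : Set ℕ | ∀ i ∈ S, i ∈ A ↔ i ∈ T} = ⋂ i ∈ S, {A : Set ℕ | i ∈ A ↔ i ∈ T} := by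
    ext A; simp
  rw [h1, real_biInter_eq_prod S (S := fun i => {i}) (fun i _ => determinedOn_mem_iff i _)
    (by intro a _ b _ hab; simpa using hab)]
  have h2 : ∀ i ∈ S, (bern p).real {A | i ∈ A ↔ i ∈ T} = if i ∈ T then (p : ℝ) else 1 - p := by
    intro i _
    split_ifs with h
    · simpa [h] using real_mem p i
    · have : {A : Set ℕ | i ∈ A ↔ i ∈ T} = {A | i ∈ A}ᶜ := by ext A; simp [h]
      have hm : MeasurableSet {A : Set ℕ | i ∈ A} := by
        simpa using (determinedOn_mem_iff i True).measurableSet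
      rw [this, probReal_compl_eq_one_sub hm, real_mem]
  rw [Finset.prod_congr rfl h2, Finset.prod_ite, Finset.prod_const, Finset.prod_const]
  congr 2
  · congr 1
    ext i; simp; exact fun h => hT h
  · rw [← Finset.card_sdiff_of_subset hT]
    congr 1
    ext i; simp

theorem DeterminedOn.real_eq_sum {E : Set (Set ℕ)} {S : Finset ℕ} (hE : DeterminedOn E S)
    (p : unitInterval) [DecidablePred fun T : Finset ℕ => (T : Set ℕ) ∈ E] :
    (bern p).real E = ∑ T ∈ S.powerset.filter (fun T : Finset ℕ => (T : Set ℕ) ∈ E),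
      (p : ℝ) ^ T.card * (1 - p : ℝ) ^ (S.card - T.card) := by
  classical
  have h1 : E = ⋃ T ∈ S.powerset.filter (fun T : Finset ℕ => (T : Set ℕ) ∈ E),
      {A : Set ℕ | ∀ i ∈ S, i ∈ A ↔ i ∈ T} := by
    ext A
    simp only [Finset.mem_filter, Finset.mem_powerset, Set.mem_iUnion, exists_prop]
    constructor
    · intro hA
      refine ⟨S.filter (· ∈ A), ⟨Finset.filter_subset _ _, hE A _ (fun i hi => ?_) hA⟩,
        fun i hi => ?_⟩ <;> simp [hi]
    · rintro ⟨T, ⟨_, hT⟩, hA⟩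
      exact hE T A (fun i hi => by simpa using (hA i hi).symm) hT
  conv_lhs => rw [h1]
  rw [measureReal_biUnion_finset]
  · refine Finset.sum_congr rfl fun T hT => real_trace_eq p ?_
    simp at hT
    exact hT.1
  · intro T hT U hU hTU
    simp only [Finset.coe_filter, Finset.mem_powerset] at hT hU
    refine Set.disjoint_left.2 fun A hA hA' => hTU ?_
    ext i
    by_cases hi : i ∈ S
    · exact (hA i hi).symm.trans (hA' i hi)
    · exact ⟨fun h => (hi (hT.1 h)).elim, fun h => (hi (hU.1 h)).elim⟩
  · intro T _
    have h2 : DeterminedOn {A : Set ℕ | ∀ i ∈ S, i ∈ A ↔ i ∈ T} S := by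
      intro A B hAB hA i hi
      exact (hAB i hi).symm.trans (hA i hi)
    exact h2.measurableSet

open Classical in
/-- The number of elements of `B` in the interval `[a, b)`. -/
def cnt (B : Set ℕ) (a b : ℕ) : ℕ := ((Finset.Ico a b).filter (· ∈ B)).card

theorem cnt_add (B : Set ℕ) {a b c : ℕ} (hab : a ≤ b) (hbc : b ≤ c) :
    cnt B a b + cnt B b c = cnt B a c := by
  classical
  rw [cnt, cnt, cnt, ← Finset.Ico_union_Ico_eq_Ico hab hbc, Finset.filter_union,
    Finset.card_union_of_disjoint]
  exact Finset.disjoint_filter_filter (Finset.Ico_disjoint_Ico_consecutive a b c)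

theorem cnt_of_subset {B : Set ℕ} {a b : ℕ} (h : ∀ i, a ≤ i → i < b → i ∈ B) :
    cnt B a b = b - a := by
  classical
  rw [cnt, Finset.filter_true_of_mem, Nat.card_Ico]
  intro i hi
  rw [Finset.mem_Ico] at hi
  exact h i hi.1 hi.2

theorem cnt_le (B : Set ℕ) (a b : ℕ) : cnt B a b ≤ b - a := by
  classical
  exact (Finset.card_filter_le _ _).trans (Nat.card_Ico a b).le

theorem cnt_of_disjoint {B : Set ℕ} {a b : ℕ} (h : ∀ i, a ≤ i → i < b → i ∉ B) :
    cnt B a b = 0 := by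
  classical
  rw [cnt, Finset.card_eq_zero, Finset.filter_eq_empty_iff]
  intro i hi
  rw [Finset.mem_Ico] at hi
  exact h i hi.1 hi.2

theorem cnt_mono_set {B C : Set ℕ} {a b : ℕ} (h : ∀ i, a ≤ i → i < b → i ∈ B → i ∈ C) :
    cnt B a b ≤ cnt C a b := by
  classical
  refine Finset.card_le_card fun i hi => ?_
  simp only [Finset.mem_filter, Finset.mem_Ico] at hi ⊢
  exact ⟨hi.1, h i hi.1.1 hi.1.2 hi.2⟩

theorem cnt_mono (B : Set ℕ) {a b c d : ℕ} (hca : c ≤ a) (hbd : b ≤ d) :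
    cnt B a b ≤ cnt B c d := by
  classical
  exact Finset.card_le_card (Finset.filter_subset_filter _ (Finset.Ico_subset_Ico hca hbd))

theorem determinedOn_cnt (K : Set ℕ) (a b : ℕ) :
    DeterminedOn {A | cnt A a b ∈ K} (Finset.Ico a b) := by
  intro A B hAB hA
  have h : cnt B a b = cnt A a b := by
    refine le_antisymm (cnt_mono_set fun i hi hi' h => ?_) (cnt_mono_set fun i hi hi' h => ?_)
    · exact (hAB i (Finset.mem_Ico.2 ⟨hi, hi'⟩)).2 h
    · exact (hAB i (Finset.mem_Ico.2 ⟨hi, hi'⟩)).1 h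
  change cnt B a b ∈ K
  rw [h]
  exact hA

theorem determinedOn_passive (S : Finset ℕ) : DeterminedOn {A | ∀ i ∈ S, i ∉ A} S :=
  fun _ _ hAB hA i hi h => hA i hi ((hAB i hi).2 h)

theorem real_passive (p : unitInterval) (S : Finset ℕ) :
    (bern p).real {A | ∀ i ∈ S, i ∉ A} = (1 - p : ℝ) ^ S.card := by
  simpa using real_trace_eq p (Finset.empty_subset S)

theorem cnt_coe {T : Finset ℕ} {a b : ℕ} (h : T ⊆ Finset.Ico a b) : cnt T a b = T.card := by
  classical
  rw [cnt]
  congr 1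
  ext i
  simpa using fun hi => Finset.mem_Ico.1 (h hi)

/-- A window of `2r + 1` vertices holds a strict majority of active ones with probability at most
`2 (4p(1-p))^r`. -/
theorem real_majority_le {p : unitInterval} (hp : (p : ℝ) ≤ 1 / 2) (r : ℕ) {a b : ℕ}
    (hab : b = a + (2 * r + 1)) :
    (bern p).real {A | r + 1 ≤ cnt A a b} ≤ 2 * (4 * p * (1 - p) : ℝ) ^ r := by
  classical
  subst hab
  have hdet := determinedOn_cnt {k | r + 1 ≤ k} a (a + (2 * r + 1))
  have h0 : (0 : ℝ) ≤ p := p.2.1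
  have hq : (p : ℝ) ≤ 1 - p := by linarith
  have hq0 : (0 : ℝ) ≤ 1 - p := by linarith
  have hq1 : (1 - p : ℝ) ≤ 1 := by linarith
  change (bern p).real {A | cnt A a (a + (2 * r + 1)) ∈ {k | r + 1 ≤ k}} ≤ _
  rw [hdet.real_eq_sum]
  refine (Finset.sum_le_card_nsmul _ _ ((p : ℝ) ^ r * (1 - p : ℝ) ^ r) ?_).trans ?_
  · intro T hT
    simp only [Finset.mem_filter, Finset.mem_powerset] at hT
    obtain ⟨hT, hT'⟩ := hT
    have hc := Finset.card_le_card hT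
    have hT'' : r + 1 ≤ T.card := by
      have : r + 1 ≤ cnt T a (a + (2 * r + 1)) := hT'
      rwa [cnt_coe hT] at this
    rw [Nat.card_Ico] at hc ⊢
    obtain ⟨j, hj⟩ := Nat.exists_eq_add_of_le hT''
    have h2 : a + (2 * r + 1) - a - T.card = r - j := by omega
    rw [h2, hj]
    calc (p : ℝ) ^ (r + 1 + j) * (1 - p : ℝ) ^ (r - j)
        = (p : ℝ) ^ r * (p ^ (1 + j) * (1 - p : ℝ) ^ (r - j)) := by ring
      _ ≤ (p : ℝ) ^ r * ((1 - p : ℝ) ^ (1 + j) * (1 - p : ℝ) ^ (r - j)) := by gcongr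
      _ = (p : ℝ) ^ r * (1 - p : ℝ) ^ (r + 1) := by
          rw [← pow_add]; congr 2; omega
      _ ≤ (p : ℝ) ^ r * (1 - p : ℝ) ^ r := by
          gcongr ?_ * ?_
          exact pow_le_pow_of_le_one hq0 hq1 (Nat.le_succ r)
  · rw [nsmul_eq_mul]
    have hc : ((Finset.Ico a (a + (2 * r + 1))).powerset.filter
        (fun T : Finset ℕ => (T : Set ℕ) ∈ {A | cnt A a (a + (2 * r + 1)) ∈ {k | r + 1 ≤ k}})).card
        ≤ 2 ^ (2 * r + 1) := by
      refine (Finset.card_filter_le _ _).trans ?_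
      rw [Finset.card_powerset, Nat.card_Ico, Nat.add_sub_cancel_left]
    calc _ ≤ ((2 ^ (2 * r + 1) : ℕ) : ℝ) * ((p : ℝ) ^ r * (1 - p : ℝ) ^ r) := by gcongr
      _ = 2 * (4 * p * (1 - p) : ℝ) ^ r := by
        push_cast
        rw [pow_succ, pow_mul, mul_pow, mul_pow]
        norm_num
        ring

theorem le_real_majority (p : unitInterval) (m : ℕ) {a b : ℕ} (hab : b = a + 2 * m) :
    ((2 * m).choose (m + 1) : ℝ) * ((p : ℝ) ^ (m + 1) * (1 - p : ℝ) ^ (m - 1)) ≤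
      (bern p).real {A | m + 1 ≤ cnt A a b} := by
  classical
  subst hab
  have hdet := determinedOn_cnt {k | m + 1 ≤ k} a (a + 2 * m)
  have h0 : (0 : ℝ) ≤ p := p.2.1
  have hq0 : (0 : ℝ) ≤ 1 - p := sub_nonneg.2 p.2.2
  change _ ≤ (bern p).real {A | cnt A a (a + 2 * m) ∈ {k | m + 1 ≤ k}}
  rw [hdet.real_eq_sum]
  have hsub : (Finset.Ico a (a + 2 * m)).powersetCard (m + 1) ⊆
      (Finset.Ico a (a + 2 * m)).powerset.filter
        (fun T : Finset ℕ => (T : Set ℕ) ∈ {A | cnt A a (a + 2 * m) ∈ {k | m + 1 ≤ k}}) := by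
    intro T hT
    rw [Finset.mem_powersetCard] at hT
    simp only [Finset.mem_filter, Finset.mem_powerset]
    refine ⟨hT.1, ?_⟩
    change m + 1 ≤ cnt T a (a + 2 * m)
    rw [cnt_coe hT.1, hT.2]
  refine le_trans ?_ (Finset.sum_le_sum_of_subset_of_nonneg hsub fun T _ _ => by positivity)
  rw [Finset.sum_congr rfl (g := fun _ => (p : ℝ) ^ (m + 1) * (1 - p : ℝ) ^ (m - 1)),
    Finset.sum_const, Finset.card_powersetCard, Nat.card_Ico, Nat.add_sub_cancel_left, nsmul_eq_mul]
  intro T hT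
  rw [Finset.mem_powersetCard] at hT
  rw [hT.2, Nat.card_Ico]
  congr 2
  omega

/-- Markov's inequality for the number of events that occur. -/
theorem mul_real_card_le_sum {Ω ι : Type*} [MeasurableSpace Ω] (μ : Measure Ω)
    [IsFiniteMeasure μ] (J : Finset ι) {E : ι → Set Ω} (hE : ∀ j ∈ J, MeasurableSet (E j)) (k : ℕ)
    {F : Set Ω} (hF : ∀ ω ∈ F, ∃ I ⊆ J, k ≤ I.card ∧ ∀ j ∈ I, ω ∈ E j) :
    (k : ℝ) * μ.real F ≤ ∑ j ∈ J, μ.real (E j) := by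
  classical
  have h1 : (k : ENNReal) * μ F ≤ ∑ j ∈ J, μ (E j) := by
    calc (k : ENNReal) * μ F
        ≤ (k : ENNReal) * μ {ω | (k : ENNReal) ≤ ∑ j ∈ J, (E j).indicator 1 ω} := by
          gcongr
          intro ω hω
          obtain ⟨I, hIJ, hk, hI⟩ := hF ω hω
          calc (k : ENNReal) ≤ (I.card : ENNReal) := by exact_mod_cast hk
            _ = ∑ j ∈ I, (E j).indicator 1 ω := by
              rw [Finset.sum_congr rfl (g := fun _ => (1 : ENNReal))
                (fun j hj => by simp [hI j hj])]
              simp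
            _ ≤ _ := Finset.sum_le_sum_of_subset hIJ
      _ ≤ ∫⁻ ω, ∑ j ∈ J, (E j).indicator 1 ω ∂μ :=
          mul_meas_ge_le_lintegral
            (Finset.measurable_fun_sum _ fun j hj => measurable_one.indicator (hE j hj)) _
      _ = ∑ j ∈ J, μ (E j) := by
          rw [lintegral_finsetSum _ fun j hj => measurable_one.indicator (hE j hj)]
          exact Finset.sum_congr rfl fun j hj => by rw [lintegral_indicator_one (hE j hj)]
  have h2 := ENNReal.toReal_mono (ENNReal.sum_ne_top.2 fun j _ => measure_ne_top μ _) h1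
  rwa [ENNReal.toReal_mul, ENNReal.toReal_sum (fun j _ => measure_ne_top μ _)] at h2

section Dynamics

variable {V : Type*} [Fintype V] {G : SimpleGraph V}

theorem ceil_half_succ (d : ℕ) : ⌈((d : ℚ) + 1) / 2⌉₊ = d / 2 + 1 := by
  rw [Nat.ceil_eq_iff (by omega)]
  rcases Nat.even_or_odd' d with ⟨k, rfl | rfl⟩
  · have : 2 * k / 2 = k := by omega
    rw [this]
    push_cast
    constructor <;> linarith
  · have : (2 * k + 1) / 2 = k := by omega
    rw [this]
    push_cast
    constructor <;> linarith

theorem threshold_le {v : V} {S : Finset V} (hS : ∀ w, G.Adj v w → w ∈ S) :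
    threshold G v ≤ S.card / 2 + 1 := by
  classical
  rw [threshold, ceil_half_succ, ← SimpleGraph.card_neighborFinset_eq_degree]
  have : (G.neighborFinset v).card ≤ S.card :=
    Finset.card_le_card fun w hw => hS w (by simpa using hw)
  exact Nat.succ_le_succ (Nat.div_le_div_right (by convert this))

theorem le_threshold {v : V} {S : Finset V} (hS : ∀ w ∈ S, G.Adj v w) :
    S.card / 2 + 1 ≤ threshold G v := by
  classical
  rw [threshold, ceil_half_succ, ← SimpleGraph.card_neighborFinset_eq_degree]
  have : S.card ≤ (G.neighborFinset v).card :=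
    Finset.card_le_card fun w hw => by simpa using hS w hw
  exact Nat.succ_le_succ (Nat.div_le_div_right (by convert this))

theorem le_activeNeighbors {A : Set V} {v : V} {S : Finset V} (hS : ∀ w ∈ S, G.Adj v w ∧ w ∈ A) :
    S.card ≤ activeNeighbors G A v :=
  Finset.card_le_card fun w hw => by simpa using hS w hw

theorem activeNeighbors_le {A : Set V} {v : V} {S : Finset V}
    (hS : ∀ w, G.Adj v w → w ∈ A → w ∈ S) : activeNeighbors G A v ≤ S.card :=
  Finset.card_le_card fun w hw => by
    simp only [Finset.mem_filter, SimpleGraph.mem_neighborFinset] at hw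
    exact hS w hw.1 hw.2

theorem step_mono {A B : Set V} (h : A ⊆ B) : step G A ⊆ step G B := by
  classical
  rintro v (hv | hv)
  · exact Or.inl (h hv)
  · refine Or.inr (le_trans (show threshold G v ≤ activeNeighbors G A v from hv) ?_)
    exact activeNeighbors_le (G := G) fun w hw hwA => by
      simpa using ⟨hw, h hwA⟩

theorem subset_step (A : Set V) : A ⊆ step G A := Set.subset_union_left

theorem Percolates.eq_univ {A F : Set V} (h : Percolates G A) (hAF : A ⊆ F)
    (hF : step G F ⊆ F) : F = Set.univ := by
  obtain ⟨t, ht⟩ := h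
  have key : ∀ t, (step G)^[t] A ⊆ F := by
    intro t
    induction t with
    | zero => exact hAF
    | succ t ih =>
      rw [Function.iterate_succ_apply']
      exact (step_mono ih).trans hF
  exact Set.univ_subset_iff.1 (ht ▸ key t)

theorem percolates_of_forall_closed {A : Set V}
    (h : ∀ F, A ⊆ F → step G F ⊆ F → F = Set.univ) : Percolates G A := by
  have hmono : Monotone fun t => (step G)^[t] A := monotone_nat_of_le_succ fun t => by
    rw [Function.iterate_succ_apply']
    exact subset_step _
  obtain ⟨t, ht⟩ := WellFoundedGT.monotone_chain_condition ⟨_, hmono⟩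
  refine ⟨t, h _ (hmono (Nat.zero_le t)) ?_⟩
  have := ht (t + 1) (Nat.le_succ t)
  simp only [OrderHom.coe_mk, Function.iterate_succ_apply'] at this
  exact this.symm.subset

end Dynamics

section Wheel

variable {n r : ℕ}

theorem wheel_adj_none (i : Fin n) : (wheel n r).Adj none (some i) := by
  simp [wheel, addUniversal]

theorem wheel_adj_some_iff {i j : Fin n} :
    (wheel n r).Adj (some i) (some j) ↔ (ring n r).Adj i j := by
  simp only [wheel, addUniversal, SimpleGraph.fromRel_adj]
  constructor
  · rintro ⟨_, (h | ⟨v, w, hv, hw, h⟩) | (h | ⟨v, w, hv, hw, h⟩)⟩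
    · cases h
    · cases hv; cases hw; exact h
    · cases h
    · cases hv; cases hw; exact h.symm
  · intro h
    exact ⟨fun he => h.ne (Option.some_injective _ he), Or.inl (Or.inr ⟨i, j, rfl, rfl, h⟩)⟩

theorem ring_adj_of_close {i j : Fin n} (hij : (i : ℕ) ≠ j) (h1 : (i : ℕ) ≤ j + r)
    (h2 : (j : ℕ) ≤ i + r) : (ring n r).Adj i j := by
  rw [ring, SimpleGraph.fromRel_adj]
  refine ⟨fun h => hij (congrArg _ h), ?_⟩
  rcases lt_or_gt_of_ne hij with h | h
  · refine Or.inl ⟨j - i, by omega, by omega, ?_⟩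
    rw [Nat.add_sub_cancel' h.le, Nat.mod_eq_of_lt j.2]
  · refine Or.inr ⟨i - j, by omega, by omega, ?_⟩
    rw [Nat.add_sub_cancel' h.le, Nat.mod_eq_of_lt i.2]

theorem close_of_ring_adj {i j : Fin n} (hi : r ≤ i) (hi' : (i : ℕ) + r < n)
    (h : (ring n r).Adj i j) : (i : ℕ) ≠ j ∧ (i : ℕ) ≤ j + r ∧ (j : ℕ) ≤ i + r := by
  rw [ring, SimpleGraph.fromRel_adj] at h
  refine ⟨fun he => h.1 (Fin.ext he), ?_⟩
  have hj := j.2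
  rcases h.2 with ⟨d, hd, hdr, he⟩ | ⟨d, hd, hdr, he⟩
  · rw [Nat.mod_eq_of_lt (by omega)] at he
    omega
  · rcases lt_or_ge ((j : ℕ) + d) n with hlt | hge
    · rw [Nat.mod_eq_of_lt hlt] at he
      omega
    · rw [Nat.mod_eq_sub_mod hge, Nat.mod_eq_of_lt (by omega)] at he
      omega

theorem threshold_wheel_some_le (i : Fin n) : threshold (wheel n r) (some i) ≤ r + 1 := by
  classical
  have hn : 0 < n := i.pos
  let up : ℕ → Option (Fin n) := fun d => some ⟨(i + d) % n, Nat.mod_lt _ hn⟩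
  let down : ℕ → Option (Fin n) := fun d => some ⟨(i + (n - d % n)) % n, Nat.mod_lt _ hn⟩
  let S : Finset (Option (Fin n)) :=
    insert none ((Finset.Icc 1 r).image up ∪ (Finset.Icc 1 r).image down)
  have hcard : S.card ≤ 2 * r + 1 := by
    refine (Finset.card_insert_le _ _).trans (Nat.succ_le_succ ?_)
    refine (Finset.card_union_le _ _).trans ?_
    have h1 := Finset.card_image_le (s := Finset.Icc 1 r) (f := up)
    have h2 := Finset.card_image_le (s := Finset.Icc 1 r) (f := down)
    rw [Nat.card_Icc] at h1 h2
    omega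
  refine (threshold_le (S := S) ?_).trans (by omega)
  rintro (_ | j) hj
  · exact Finset.mem_insert_self _ _
  rw [wheel_adj_some_iff, ring, SimpleGraph.fromRel_adj] at hj
  refine Finset.mem_insert_of_mem (Finset.mem_union.2 ?_)
  rcases hj.2 with ⟨d, hd, hdr, he⟩ | ⟨d, hd, hdr, he⟩
  · exact Or.inl (Finset.mem_image.2 ⟨d, Finset.mem_Icc.2 ⟨hd, hdr⟩,
      congrArg some (Fin.ext he.symm)⟩)
  · refine Or.inr (Finset.mem_image.2 ⟨d, Finset.mem_Icc.2 ⟨hd, hdr⟩,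
      congrArg some (Fin.ext ?_)⟩)
    have hj' := j.2
    have hd' := Nat.mod_lt d hn
    change ((i : ℕ) + (n - d % n)) % n = j
    rw [← Nat.add_mod_mod] at he
    rcases lt_or_ge ((j : ℕ) + d % n) n with hlt | hge
    · rw [Nat.mod_eq_of_lt hlt] at he
      rw [he, show (j : ℕ) + d % n + (n - d % n) = j + n by omega, Nat.add_mod_right,
        Nat.mod_eq_of_lt hj']
    · rw [Nat.mod_eq_sub_mod hge, Nat.mod_eq_of_lt (by omega)] at he
      rw [he, show (j : ℕ) + d % n - n + (n - d % n) = j by omega, Nat.mod_eq_of_lt hj']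

theorem threshold_wheel_none : threshold (wheel n r) none = n / 2 + 1 := by
  classical
  have hc : (Finset.univ.image (some : Fin n → Option (Fin n))).card = n := by
    rw [Finset.card_image_of_injective _ (Option.some_injective _), Finset.card_fin]
  apply le_antisymm
  · conv_rhs => rw [← hc]
    refine threshold_le ?_
    rintro (_ | j) hj
    · exact ((wheel n r).loopless.irrefl _ hj).elim
    · simp
  · conv_lhs => rw [← hc]
    refine le_threshold fun w hw => ?_
    obtain ⟨j, _, rfl⟩ := Finset.mem_image.1 hw
    exact wheel_adj_none j

/-- The vertex of the wheel with a given number; numbers outside the ring denote the hub. -/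
def vert (n i : ℕ) : Option (Fin n) := if h : i < n then some ⟨i, h⟩ else none

theorem vert_of_lt {i : ℕ} (h : i < n) : vert n i = some ⟨i, h⟩ := dif_pos h

theorem vert_val (i : Fin n) : vert n i = some i := dif_pos i.2

theorem vert_injOn : Set.InjOn (vert n) {i | i < n} := by
  intro i hi j hj hij
  rw [vert_of_lt hi, vert_of_lt hj] at hij
  simpa using hij

/-- The numbers of the ring vertices in a set of vertices of the wheel. -/
def ringSet (F : Set (Option (Fin n))) : Set ℕ := {i | i < n ∧ vert n i ∈ F}

open Classical in
theorem card_image_vert (F : Set (Option (Fin n))) (a b : ℕ) :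
    (((Finset.Ico a b).filter (· ∈ ringSet F)).image (vert n)).card = cnt (ringSet F) a b := by
  rw [Finset.card_image_of_injOn, cnt]
  refine vert_injOn.mono fun i hi => ?_
  simp only [Finset.coe_filter] at hi
  exact hi.2.1

theorem wheel_adj_vert {i j : ℕ} (hi : i < n) (hj : j < n) (hij : i ≠ j) (h1 : i ≤ j + r)
    (h2 : j ≤ i + r) : (wheel n r).Adj (vert n i) (vert n j) := by
  rw [vert_of_lt hi, vert_of_lt hj, wheel_adj_some_iff]
  exact ring_adj_of_close hij h1 h2

theorem mem_ringSet_of_succ_le_cnt {F : Set (Option (Fin n))} (hF : step (wheel n r) F ⊆ F)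
    {i : ℕ} (hi : i < n) (h : r + 1 ≤ cnt (ringSet F) (i - r) (i + r + 1)) : i ∈ ringSet F := by
  classical
  by_contra hiF
  refine hiF ⟨hi, hF (Or.inr ?_)⟩
  refine le_trans (b := r + 1) ?_ (h.trans ?_)
  · rw [vert_of_lt hi]
    exact threshold_wheel_some_le _
  · rw [← card_image_vert]
    refine le_activeNeighbors fun w hw => ?_
    simp only [Finset.mem_image, Finset.mem_filter, Finset.mem_Ico] at hw
    obtain ⟨j, ⟨hj, hjF⟩, rfl⟩ := hw
    exact ⟨wheel_adj_vert hi hjF.1 (by rintro rfl; exact hiF hjF) (by omega) (by omega), hjF.2⟩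

theorem mem_ringSet_of_le_cnt {F : Set (Option (Fin n))} (hF : step (wheel n r) F ⊆ F)
    (hhub : none ∈ F) {i : ℕ} (hi : i < n)
    (h : r ≤ cnt (ringSet F) (i - r) (i + r + 1)) : i ∈ ringSet F := by
  classical
  by_contra hiF
  refine hiF ⟨hi, hF (Or.inr ?_)⟩
  refine le_trans (b := r + 1) ?_ ((Nat.add_le_add_right h 1).trans ?_)
  · rw [vert_of_lt hi]
    exact threshold_wheel_some_le _
  · rw [← card_image_vert, ← Finset.card_insert_of_notMem (a := none)]
    · refine le_activeNeighbors fun w hw => ?_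
      rw [Finset.mem_insert] at hw
      rcases hw with rfl | hw
      · rw [vert_of_lt hi]
        exact ⟨(wheel_adj_none _).symm, hhub⟩
      simp only [Finset.mem_image, Finset.mem_filter, Finset.mem_Ico] at hw
      obtain ⟨j, ⟨hj, hjF⟩, rfl⟩ := hw
      exact ⟨wheel_adj_vert hi hjF.1 (by rintro rfl; exact hiF hjF) (by omega) (by omega), hjF.2⟩
    · intro hw
      simp only [Finset.mem_image, Finset.mem_filter] at hw
      obtain ⟨j, ⟨_, hjF⟩, he⟩ := hw
      rw [vert_of_lt hjF.1] at he
      cases he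

theorem none_mem_of_le_cnt {F : Set (Option (Fin n))} (hF : step (wheel n r) F ⊆ F)
    (h : n / 2 + 1 ≤ cnt (ringSet F) 0 n) : none ∈ F := by
  classical
  refine hF (Or.inr ?_)
  refine le_trans threshold_wheel_none.le (h.trans ?_)
  rw [← card_image_vert]
  refine le_activeNeighbors fun w hw => ?_
  simp only [Finset.mem_image, Finset.mem_filter, Finset.mem_Ico] at hw
  obtain ⟨j, ⟨hj, hjF⟩, rfl⟩ := hw
  refine ⟨?_, hjF.2⟩
  rw [vert_of_lt hjF.1]
  exact wheel_adj_none _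

/-- A set of ring vertices that is at most half of the ring and outside of which every vertex has
at most `r` neighbours in the set confines the process while the hub is passive. -/
theorem not_percolates_of_confined {A : Set (Option (Fin n))} {Z : Set ℕ} (hA : none ∉ A)
    (hAZ : ringSet A ⊆ Z) (hhalf : cnt Z 0 n ≤ n / 2)
    (hZ : ∀ i < n, i ∉ Z → r ≤ i ∧ i + r < n ∧ cnt Z (i - r) (i + r + 1) ≤ r) :
    ¬ Percolates (wheel n r) A := by
  classical
  intro hperc
  let F : Set (Option (Fin n)) := {x | ∃ i : Fin n, x = some i ∧ (i : ℕ) ∈ Z}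
  have hsome {i : Fin n} : some i ∈ F ↔ (i : ℕ) ∈ Z := by simp [F]
  have hnone : none ∉ F := by simp [F]
  have hFZ : ringSet F ⊆ Z := by
    rintro i ⟨hi, hiF⟩
    rw [vert_of_lt hi, hsome] at hiF
    exact hiF
  have hmem {i : Fin n} (hi : (i : ℕ) ∈ Z) : (i : ℕ) ∈ ringSet F :=
    ⟨i.2, by rw [vert_val, hsome]; exact hi⟩
  refine hnone ((hperc.eq_univ (F := F) ?_ ?_).symm ▸ Set.mem_univ _)
  · rintro (_ | i) hi
    · exact (hA hi).elim
    · exact hsome.2 (hAZ ⟨i.2, by rwa [vert_val]⟩)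
  · rintro (_ | i) (hi | hi)
    · exact hi
    · exfalso
      have h1 : threshold (wheel n r) none ≤ activeNeighbors (wheel n r) F none := hi
      rw [threshold_wheel_none] at h1
      have h2 : activeNeighbors (wheel n r) F none ≤ cnt (ringSet F) 0 n := by
        rw [← card_image_vert]
        refine activeNeighbors_le ?_
        rintro (_ | j) _ hj
        · exact (hnone hj).elim
        · exact Finset.mem_image.2 ⟨j, by simpa using hmem (hsome.1 hj), vert_val j⟩
      have h3 : cnt (ringSet F) 0 n ≤ cnt Z 0 n := cnt_mono_set fun i _ _ h => hFZ h
      omega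
    · exact hi
    · by_contra hiF
      rw [hsome] at hiF
      obtain ⟨hr, hr', hc⟩ := hZ i i.2 hiF
      have h1 : threshold (wheel n r) (some i) ≤ activeNeighbors (wheel n r) F (some i) := hi
      have h2 : r + 1 ≤ threshold (wheel n r) (some i) := by
        have hcard : (((Finset.Ico ((i : ℕ) - r) (i + r + 1)).erase i).image (vert n)).card
            = 2 * r := by
          rw [Finset.card_image_of_injOn, Finset.card_erase_of_mem, Nat.card_Ico]
          · omega
          · rw [Finset.mem_Ico]; omega
          · refine vert_injOn.mono fun j hj => ?_
            simp only [Finset.coe_erase, Finset.coe_Ico] at hj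
            have := hj.1.2
            change j < n
            omega
        calc r + 1 = 2 * r / 2 + 1 := by omega
          _ ≤ _ := by
            rw [← hcard]
            refine le_threshold fun w hw => ?_
            simp only [Finset.mem_image, Finset.mem_erase, Finset.mem_Ico] at hw
            obtain ⟨j, ⟨hj, hj'⟩, rfl⟩ := hw
            rw [← vert_val]
            exact wheel_adj_vert i.2 (by omega) hj.symm (by omega) (by omega)
      have h3 : activeNeighbors (wheel n r) F (some i) ≤ cnt (ringSet F) (i - r) (i + r + 1) := by
        rw [← card_image_vert]
        refine activeNeighbors_le ?_
        rintro (_ | j) hij hj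
        · exact (hnone hj).elim
        · rw [wheel_adj_some_iff] at hij
          obtain ⟨-, h4, h5⟩ := close_of_ring_adj hr hr' hij
          refine Finset.mem_image.2 ⟨j, ?_, vert_val j⟩
          simp only [Finset.mem_filter, Finset.mem_Ico]
          exact ⟨by omega, hmem (hsome.1 hj)⟩
      have h6 : cnt (ringSet F) (i - r) (i + r + 1) ≤ cnt Z (i - r) (i + r + 1) :=
        cnt_mono_set fun i _ _ h => hFZ h
      omega

end Wheel

theorem forall_mem_of_run_right {D : Set ℕ} {a r e : ℕ} (hrun : ∀ i, a ≤ i → i < a + r → i ∈ D)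
    (hstep : ∀ i, a + r ≤ i → i < e → (∀ j, i - r ≤ j → j < i → j ∈ D) → i ∈ D) :
    ∀ i, a ≤ i → i < e → i ∈ D := by
  intro i
  induction i using Nat.strong_induction_on with
  | _ i ih =>
    intro hai hie
    rcases lt_or_ge i (a + r) with h | h
    · exact hrun i hai h
    · exact hstep i h hie fun j hj hji => ih j hji (by omega) (by omega)

theorem forall_mem_of_run_left {D : Set ℕ} {a r s : ℕ} (hrun : ∀ i, a ≤ i → i < a + r → i ∈ D)
    (hstep : ∀ i, s ≤ i → i < a → (∀ j, i < j → j ≤ i + r → j ∈ D) → i ∈ D) :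
    ∀ i, s ≤ i → i < a + r → i ∈ D := by
  have key : ∀ k i, a + r ≤ i + k → s ≤ i → i < a + r → i ∈ D := by
    intro k
    induction k with
    | zero => intro i h1 _ h3; omega
    | succ k ih =>
      intro i h1 h2 h3
      rcases lt_or_ge i a with h | h
      · exact hstep i h2 h fun j hj hj' => ih j (by omega) (by omega) (by omega)
      · exact hrun i h h3
  intro i
  exact key (a + r) i (by omega)

theorem one_le_cnt {B : Set ℕ} {a b i : ℕ} (ha : a ≤ i) (hb : i < b) (hi : i ∈ B) :
    1 ≤ cnt B a b := by
  classical
  exact Finset.card_pos.2 ⟨i, by simp [ha, hb, hi]⟩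

/-- A run of `r` vertices spreads over `[s, e)`, up to distance `r` from the boundary, if there are
no `r + 1` consecutive passive vertices. -/
theorem forall_mem_of_run {D A : Set ℕ} {a r s e : ℕ}
    (hrule : ∀ i < e, r + 1 ≤ cnt D (i - r) (i + r + 1) → i ∈ D)
    (hAD : A ⊆ D) (hrun : ∀ i, a ≤ i → i < a + r → i ∈ D)
    (hA : ∀ x, s ≤ x → x + r + 1 ≤ e → ∃ i, x ≤ i ∧ i ≤ x + r ∧ i ∈ A)
    (hsa : s ≤ a) (hae : a + r ≤ e) :
    ∀ i, s + r ≤ i → i + r < e → i ∈ D := by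
  have hright : ∀ i, a ≤ i → i < e - r → i ∈ D := by
    refine forall_mem_of_run_right hrun fun i h1 h2 h3 => hrule i (by omega) ?_
    obtain ⟨j, hj, hj', hjA⟩ := hA i (by omega) (by omega)
    rw [← cnt_add D (b := i) (by omega) (by omega), cnt_of_subset h3]
    have := one_le_cnt hj (show j < i + r + 1 by omega) (hAD hjA)
    omega
  have hleft : ∀ i, s + r ≤ i → i < a + r → i ∈ D := by
    refine forall_mem_of_run_left hrun fun i h1 h2 h3 => hrule i (by omega) ?_
    obtain ⟨j, hj, hj', hjA⟩ := hA (i - r) (by omega) (by omega)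
    rw [← cnt_add D (b := i + 1) (by omega) (by omega),
      cnt_of_subset (a := i + 1) fun j hj hj' => h3 j (by omega) (by omega)]
    have := one_le_cnt hj (show j < i + 1 by omega) (hAD hjA)
    omega
  intro i h1 h2
  rcases lt_or_ge i a with h | h
  · exact hleft i h1 (by omega)
  · exact hright i h (by omega)

/-- If consecutive blocks of length `2m` contain at least `m + 1` elements of `A` each, then `A` has
density almost `(m+1)/(2m)` on every long interval. -/
theorem le_cnt_of_blocks {A : Set ℕ} {c m K : ℕ} (hm : 0 < m)
    (hA : ∀ j < K, m + 1 ≤ cnt A (c + 2 * m * j) (c + 2 * m * (j + 1))) {x y : ℕ} (hcx : c ≤ x)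
    (hy : y ≤ c + 2 * m * K) :
    (m + 1) * (y - x) ≤ 2 * m * cnt A x y + 4 * m * (m + 1) := by
  obtain ⟨x, rfl⟩ := Nat.exists_eq_add_of_le hcx
  rcases le_total y (c + x) with hyx | hyx
  · rw [Nat.sub_eq_zero_of_le hyx]
    simp
  obtain ⟨y, rfl⟩ := Nat.exists_eq_add_of_le (hcx.trans hyx)
  have hb : 0 < 2 * m := by omega
  have hx1 := Nat.div_add_mod x (2 * m)
  have hx2 := Nat.mod_lt x hb
  have hy1 := Nat.div_add_mod y (2 * m)
  have hy2 := Nat.mod_lt y hb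
  have hjK : y / (2 * m) ≤ K := by
    rw [Nat.div_le_iff_le_mul_add_pred hb]
    omega
  set i := x / (2 * m)
  set j := y / (2 * m)
  have key : ∀ d, i + 1 + d ≤ K →
      (m + 1) * d ≤ cnt A (c + 2 * m * (i + 1)) (c + 2 * m * (i + 1 + d)) := by
    intro d
    induction d with
    | zero => simp
    | succ d ih =>
      intro hd
      have h1 := ih (by omega)
      have h2 := hA (i + 1 + d) (by omega)
      rw [← cnt_add A (b := c + 2 * m * (i + 1 + d))
        (Nat.add_le_add_left (Nat.mul_le_mul_left _ (by omega)) _)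
        (Nat.add_le_add_left (Nat.mul_le_mul_left _ (by omega)) _)]
      calc (m + 1) * (d + 1) = (m + 1) * d + (m + 1) := by ring
        _ ≤ _ := Nat.add_le_add h1 h2
  rcases le_total j (i + 1) with hji | hji
  · have h1 : c + y - (c + x) ≤ 4 * m := by
      have : 2 * m * j ≤ 2 * m * (i + 1) := by gcongr
      rw [mul_add] at this
      omega
    calc (m + 1) * (c + y - (c + x)) ≤ (m + 1) * (4 * m) := by gcongr
      _ = 4 * m * (m + 1) := by ring
      _ ≤ _ := Nat.le_add_left _ _
  · obtain ⟨d, hd⟩ := Nat.exists_eq_add_of_le hji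
    have h1 := key d (by omega)
    rw [← hd] at h1
    have h2 : cnt A (c + 2 * m * (i + 1)) (c + 2 * m * j) ≤ cnt A (c + x) (c + y) := by
      apply cnt_mono
      · rw [mul_add]; omega
      · omega
    have h3 : c + y - (c + x) ≤ 2 * m * d + 4 * m := by
      rw [hd, mul_add, mul_add] at hy1
      omega
    calc (m + 1) * (c + y - (c + x)) ≤ (m + 1) * (2 * m * d + 4 * m) := by gcongr
      _ = 2 * m * ((m + 1) * d) + 4 * m * (m + 1) := by ring
      _ ≤ _ := by gcongr; exact h1.trans h2

/-- A window of slightly more than half density activates its centre. -/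
theorem forall_mem_of_blocks {D A : Set ℕ} {c m K r : ℕ} (hm : 3 ≤ m) (hr : 4 * m * (m + 1) + m ≤ r)
    (hK : 2 * r + 1 ≤ 2 * m * K)
    (hrule : ∀ i < c + 2 * m * K, r + 1 ≤ cnt D (i - r) (i + r + 1) → i ∈ D) (hAD : A ⊆ D)
    (hA : ∀ j < K, m + 1 ≤ cnt A (c + 2 * m * j) (c + 2 * m * (j + 1))) :
    ∀ y, 2 * y ≤ r + 1 → ∀ i, c + r ≤ i + y → i < c + r + y → i ∈ D := by
  have hdens {x y : ℕ} (hx : c ≤ x) (hy : y ≤ c + 2 * r + 1) :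
      (m + 1) * (y - x) ≤ 2 * m * cnt D x y + 4 * m * (m + 1) := by
    refine (le_cnt_of_blocks (by omega) hA hx (by omega)).trans ?_
    gcongr
    exact cnt_mono_set fun i _ _ h => hAD h
  intro y
  induction y with
  | zero => intro _ i h1 h2; omega
  | succ y ih =>
    intro hy
    have ih := ih (by omega)
    have hR : c + r + y ∈ D := by
      refine hrule _ (by omega) ?_
      have h1 := hdens (x := c + y) (y := c + r - y) (by omega) (by omega)
      have h2 := hdens (x := c + r + y + 1) (y := c + 2 * r + 1) (by omega) (by omega)
      have h3 := cnt_of_subset (B := D) (a := c + r - y) (b := c + r + y)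
        fun i hi hi' => ih i (by omega) hi'
      have h4 := cnt_add D (a := c + y) (b := c + r - y) (c := c + r + y) (by omega) (by omega)
      have h5 := cnt_add D (a := c + y) (b := c + r + y) (c := c + r + y + 1) (by omega) (by omega)
      have h6 := cnt_add D (a := c + y) (b := c + r + y + 1) (c := c + 2 * r + 1)
        (by omega) (by omega)
      have h7 := cnt_mono D (a := c + y) (b := c + 2 * r + 1) (c := c + r + y - r)
        (d := c + r + y + r + 1) (by omega) (by omega)
      have e1 : c + r - y - (c + y) = r - 2 * y := by omega
      have e2 : c + 2 * r + 1 - (c + r + y + 1) = r - y := by omega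
      rw [e1] at h1
      rw [e2] at h2
      have hsum : 2 * y + cnt D (c + y) (c + r - y) + cnt D (c + r + y + 1) (c + 2 * r + 1) ≤
          cnt D (c + r + y - r) (c + r + y + r + 1) := by omega
      refine le_trans ?_ hsum
      generalize cnt D (c + y) (c + r - y) = u at *
      generalize cnt D (c + r + y + 1) (c + 2 * r + 1) = v at *
      obtain ⟨w, rfl⟩ : ∃ w, r = 2 * y + w := ⟨r - 2 * y, by omega⟩
      have e3 : 2 * y + w - 2 * y = w := by omega
      have e4 : 2 * y + w - y = y + w := by omega
      rw [e3] at h1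
      rw [e4] at h2
      by_contra hlt
      have hlt : 2 * y + u + v ≤ 2 * y + w := by omega
      have : 2 * m * (2 * y + u + v) ≤ 2 * m * (2 * y + w) := by gcongr
      have hmy : 3 * y ≤ m * y := by gcongr
      nlinarith
    have hL : c + r - y - 1 ∈ D := by
      refine hrule _ (by omega) ?_
      have h1 := hdens (x := c) (y := c + r - y - 1) (by omega) (by omega)
      have h2 := hdens (x := c + r + y + 1) (y := c + 2 * r - y) (by omega) (by omega)
      have h3 := cnt_of_subset (B := D) (a := c + r - y) (b := c + r + y + 1)
        fun i hi hi' => by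
          rcases Nat.lt_succ_iff_lt_or_eq.1 hi' with h | rfl
          · exact ih i (by omega) h
          · exact hR
      have h4 := cnt_add D (a := c) (b := c + r - y - 1) (c := c + r - y) (by omega) (by omega)
      have h5 := cnt_add D (a := c) (b := c + r - y) (c := c + r + y + 1) (by omega) (by omega)
      have h6 := cnt_add D (a := c) (b := c + r + y + 1) (c := c + 2 * r - y)
        (by omega) (by omega)
      have h7 := cnt_mono D (a := c) (b := c + 2 * r - y) (c := c + r - y - 1 - r)
        (d := c + r - y - 1 + r + 1) (by omega) (by omega)
      have e1 : c + r - y - 1 - c = r - y - 1 := by omega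
      have e2 : c + 2 * r - y - (c + r + y + 1) = r - 2 * y - 1 := by omega
      rw [e1] at h1
      rw [e2] at h2
      have hsum : 2 * y + 1 + cnt D c (c + r - y - 1) + cnt D (c + r + y + 1) (c + 2 * r - y) ≤
          cnt D (c + r - y - 1 - r) (c + r - y - 1 + r + 1) := by omega
      refine le_trans ?_ hsum
      generalize cnt D c (c + r - y - 1) = u at *
      generalize cnt D (c + r + y + 1) (c + 2 * r - y) = v at *
      obtain ⟨w, rfl⟩ : ∃ w, r = 2 * y + w + 1 := ⟨r - 2 * y - 1, by omega⟩
      have e3 : 2 * y + w + 1 - y - 1 = y + w := by omega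
      have e4 : 2 * y + w + 1 - 2 * y - 1 = w := by omega
      rw [e3] at h1
      rw [e4] at h2
      by_contra hlt
      have hlt : 2 * y + 1 + u + v ≤ 2 * y + w + 1 := by omega
      have : 2 * m * (2 * y + 1 + u + v) ≤ 2 * m * (2 * y + w + 1) := by gcongr
      have hmy : 3 * y ≤ m * y := by gcongr
      nlinarith
    intro i h1 h2
    rcases Nat.lt_or_ge i (c + r - y) with h | h
    · have : i = c + r - y - 1 := by omega
      exact this ▸ hL
    · rcases Nat.lt_succ_iff_lt_or_eq.1 (show i < c + r + y + 1 from h2) with h' | rfl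
      · exact ih i (by omega) h'
      · exact hR

/-- The number of a vertex of the wheel: ring vertices keep their number, the hub gets `n`. -/
def code (n : ℕ) (x : Option (Fin n)) : ℕ := x.elim n (fun i => (i : ℕ))

theorem code_injective (n : ℕ) : Function.Injective (code n) := by
  rintro (_ | i) (_ | j) h
  · rfl
  · exact absurd h (ne_of_gt j.2)
  · exact absurd h (ne_of_lt i.2)
  · exact congrArg some (Fin.ext h)

theorem code_vert {n i : ℕ} (hi : i < n) : code n (vert n i) = i := by
  rw [vert_of_lt hi]
  rfl

theorem percolationProb_eq {n : ℕ} (G : SimpleGraph (Option (Fin n))) (p : unitInterval) :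
    percolationProb G p = bern p {B | Percolates G (code n ⁻¹' B)} := by
  rw [percolationProb, setBernoulli_univ_eq_map (code_injective n),
    Measure.map_apply (measurable_preimage _) (Set.toFinite _).measurableSet]
  rfl

theorem measurableSet_percolates {n : ℕ} (G : SimpleGraph (Option (Fin n))) :
    MeasurableSet {B : Set ℕ | Percolates G (code n ⁻¹' B)} :=
  measurable_preimage (code n) (Set.toFinite {A | Percolates G A}).measurableSet

/-- `K` consecutive blocks of length `2m`, starting from `c`, with more than half of each block
active. -/
def Seeded (m K c : ℕ) : Set (Set ℕ) :=
  {A | ∀ j < K, m + 1 ≤ cnt A (c + 2 * m * j) (c + 2 * m * (j + 1))}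

/-- The interval of length `2mKT` starting from `s` contains no `r + 1` consecutive passive
vertices, and one of its `T` subintervals of length `2mK` is seeded. -/
def Good (r m K T s : ℕ) : Set (Set ℕ) :=
  {A | (∀ x, s ≤ x → x + r + 1 ≤ s + 2 * m * K * T → ∃ i, x ≤ i ∧ i ≤ x + r ∧ i ∈ A) ∧
    ∃ t < T, A ∈ Seeded m K (s + 2 * m * K * t)}

theorem seeded_eq (m K c : ℕ) : Seeded m K c =
    ⋂ j ∈ Finset.range K, {A | m + 1 ≤ cnt A (c + 2 * m * j) (c + 2 * m * (j + 1))} := by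
  ext A; simp [Seeded]

theorem pairwiseDisjoint_blocks (J : Set ℕ) (c l : ℕ) :
    J.PairwiseDisjoint fun j => Finset.Ico (c + l * j) (c + l * (j + 1)) := by
  intro i _ j _ hij
  rw [Function.onFun, Finset.disjoint_left]
  intro x hx hx'
  rw [Finset.mem_Ico] at hx hx'
  rcases lt_or_gt_of_ne hij with h | h
  · have : l * (i + 1) ≤ l * j := Nat.mul_le_mul_left _ h
    omega
  · have : l * (j + 1) ≤ l * i := Nat.mul_le_mul_left _ h
    omega

theorem block_subset {c l j K : ℕ} (hj : j < K) :
    Finset.Ico (c + l * j) (c + l * (j + 1)) ⊆ Finset.Ico c (c + l * K) := by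
  apply Finset.Ico_subset_Ico (Nat.le_add_right _ _)
  have : l * (j + 1) ≤ l * K := Nat.mul_le_mul_left _ hj
  omega

theorem determinedOn_seeded (m K c : ℕ) :
    DeterminedOn (Seeded m K c) (Finset.Ico c (c + 2 * m * K)) := by
  rw [seeded_eq]
  refine (DeterminedOn.biInter fun j _ => determinedOn_cnt {k | m + 1 ≤ k} _ _).mono ?_
  exact Finset.biUnion_subset.2 fun j hj => block_subset (Finset.mem_range.1 hj)

theorem pow_le_real_seeded {p : unitInterval} {m : ℕ} {P : ℝ} (hP0 : 0 ≤ P)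
    (hP : ∀ a, P ≤ (bern p).real {A | m + 1 ≤ cnt A a (a + 2 * m)}) (K c : ℕ) :
    P ^ K ≤ (bern p).real (Seeded m K c) := by
  rw [seeded_eq, real_biInter_eq_prod (Finset.range K)
    (E := fun j => {A | m + 1 ≤ cnt A (c + 2 * m * j) (c + 2 * m * (j + 1))})
    (fun j _ => determinedOn_cnt {k | m + 1 ≤ k} _ _) (pairwiseDisjoint_blocks _ _ _)]
  calc P ^ K = ∏ _j ∈ Finset.range K, P := by simp
    _ ≤ _ := Finset.prod_le_prod (fun _ _ => hP0) fun j _ => by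
      have := hP (c + 2 * m * j)
      rwa [add_assoc, ← Nat.mul_succ] at this

theorem determinedOn_good (r m K T s : ℕ) :
    DeterminedOn (Good r m K T s) (Finset.Ico s (s + 2 * m * K * T)) := by
  rintro A B hAB ⟨h1, t, ht, h2⟩
  refine ⟨fun x hx hx' => ?_, t, ht, ?_⟩
  · obtain ⟨i, hi, hi', hiA⟩ := h1 x hx hx'
    exact ⟨i, hi, hi', (hAB i (Finset.mem_Ico.2 ⟨by omega, by omega⟩)).1 hiA⟩
  · refine determinedOn_seeded m K _ A B (fun i hi => hAB i ?_) h2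
    exact block_subset (l := 2 * m * K) ht (by rwa [Nat.mul_succ, ← add_assoc])

theorem real_compl_good_le {p : unitInterval} {m : ℕ} {P : ℝ} (hP0 : 0 ≤ P)
    (hP : ∀ a, P ≤ (bern p).real {A | m + 1 ≤ cnt A a (a + 2 * m)}) (r K T s : ℕ) :
    (bern p).real (Good r m K T s)ᶜ ≤
      (2 * m * K * T : ℕ) * (1 - p : ℝ) ^ (r + 1) + (1 - P ^ K) ^ T := by
  have hsub : (Good r m K T s)ᶜ ⊆
      (⋃ x ∈ Finset.Ico s (s + 2 * m * K * T), {A | ∀ i ∈ Finset.Ico x (x + r + 1), i ∉ A}) ∪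
      ⋂ t ∈ Finset.range T, (Seeded m K (s + 2 * m * K * t))ᶜ := by
    intro A hA
    by_contra hcon
    simp only [Set.mem_union, Set.mem_iUnion, Set.mem_iInter, not_or, not_exists, not_forall] at hcon
    refine hA ⟨fun x hx hx' => ?_, ?_⟩
    · have := hcon.1 x (Finset.mem_Ico.2 ⟨hx, by omega⟩)
      change ¬ ∀ i ∈ _, _ at this
      push Not at this
      obtain ⟨i, hi, hiA⟩ := this
      rw [Finset.mem_Ico] at hi
      exact ⟨i, hi.1, by omega, hiA⟩
    · obtain ⟨t, ht, h⟩ := hcon.2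
      exact ⟨t, Finset.mem_range.1 ht, not_not.1 h⟩
  refine (measureReal_mono hsub).trans ((measureReal_union_le _ _).trans (add_le_add ?_ ?_))
  · refine (measureReal_biUnion_finset_le _ _).trans ?_
    rw [Finset.sum_congr rfl (g := fun _ => (1 - p : ℝ) ^ (r + 1)), Finset.sum_const,
      Nat.card_Ico, Nat.add_sub_cancel_left, nsmul_eq_mul]
    intro x _
    rw [real_passive, Nat.card_Ico]
    congr 1
    omega
  · rw [real_biInter_eq_prod (Finset.range T)
      (S := fun t => Finset.Ico (s + 2 * m * K * t) (s + 2 * m * K * (t + 1)))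
      (fun t _ => ?_) (pairwiseDisjoint_blocks _ _ _)]
    · calc _ ≤ ∏ _t ∈ Finset.range T, (1 - P ^ K) :=
            Finset.prod_le_prod (fun _ _ => measureReal_nonneg) fun t _ => by
              rw [probReal_compl_eq_one_sub (determinedOn_seeded _ _ _).measurableSet]
              linarith [pow_le_real_seeded hP0 hP K (s + 2 * m * K * t)]
        _ = _ := by simp
    · have := (determinedOn_seeded m K (s + 2 * m * K * t)).compl
      rwa [add_assoc, ← Nat.mul_succ] at this

theorem forall_mem_of_good {D A : Set ℕ} {r m K T s : ℕ} (hm : 3 ≤ m)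
    (hr : 4 * m * (m + 1) + m ≤ r) (hK : 2 * r + 1 ≤ 2 * m * K)
    (hrule : ∀ i < s + 2 * m * K * T, r + 1 ≤ cnt D (i - r) (i + r + 1) → i ∈ D) (hAD : A ⊆ D)
    (hA : A ∈ Good r m K T s) : ∀ i, s + r ≤ i → i + r < s + 2 * m * K * T → i ∈ D := by
  obtain ⟨h1, t, ht, h2⟩ := hA
  have hle : 2 * m * K * t + 2 * m * K ≤ 2 * m * K * T := Nat.mul_le_mul_left _ ht
  have hrun := forall_mem_of_blocks hm hr hK (fun i hi => hrule i (by omega)) hAD h2 ((r + 1) / 2)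
    (by omega)
  refine forall_mem_of_run (a := s + 2 * m * K * t + r - (r + 1) / 2) hrule hAD
    (fun i hi hi' => hrun i (by omega) (by omega)) h1 (by omega) (by omega)

theorem mul_card_le_cnt {D : Set ℕ} {M N : ℕ} {Q : ℕ → Prop} [DecidablePred Q]
    (hQ : ∀ j, Q j → N ≤ cnt D (M * j) (M * (j + 1))) (k : ℕ) :
    N * ((Finset.range k).filter Q).card ≤ cnt D 0 (M * k) := by
  induction k with
  | zero => simp
  | succ k ih =>
    rw [← cnt_add D (b := M * k) (Nat.zero_le _) (Nat.mul_le_mul_left _ (Nat.le_succ k)),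
      Finset.range_add_one, Finset.filter_insert]
    split_ifs with h
    · rw [Finset.card_insert_of_notMem (by simp), mul_add, mul_one]
      exact Nat.add_le_add ih (hQ k h)
    · exact ih.trans (Nat.le_add_right _ _)

open Classical in
theorem percolates_of_good {n r m K T M : ℕ} {B : Set ℕ} (hM : M = 2 * m * K * T) (hm : 3 ≤ m)
    (hr : 4 * m * (m + 1) + m ≤ r) (hK : 2 * r + 1 ≤ 2 * m * K) (hMr : 16 * r ≤ M)
    (hn : 16 * M ≤ n)
    (hB : 4 * ((Finset.range (n / M)).filter fun j => B ∉ Good r m K T (M * j)).card < n / M) :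
    Percolates (wheel n r) (code n ⁻¹' B) := by
  have hr0 : 0 < r := by omega
  have hkM : M * (n / M) ≤ n := Nat.mul_div_le n M
  have hkM' : n < M * (n / M) + M := by
    have := Nat.div_add_mod n M
    have := Nat.mod_lt n (show 0 < M by omega)
    omega
  refine percolates_of_forall_closed fun F hAF hF => ?_
  let A : Set ℕ := {i | i ∈ B ∧ i < n}
  have hAD : A ⊆ ringSet F := fun i hi =>
    ⟨hi.2, hAF (show code n (vert n i) ∈ B by rw [code_vert hi.2]; exact hi.1)⟩
  have hfull (j : ℕ) (hj : j < n / M) (hj' : B ∈ Good r m K T (M * j)) :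
      ∀ i, M * j + r ≤ i → i + r < M * j + M → i ∈ ringSet F := by
    have hle : M * j + M ≤ n := (Nat.mul_le_mul_left M hj).trans hkM
    subst hM
    refine forall_mem_of_good hm hr hK
      (fun i hi => mem_ringSet_of_succ_le_cnt hF (by omega)) hAD ?_
    refine determinedOn_good _ _ _ _ _ B A (fun i hi => ?_) hj'
    rw [Finset.mem_Ico] at hi
    exact ⟨fun h => ⟨h, by omega⟩, fun h => h.1⟩
  have hcard : ((Finset.range (n / M)).filter fun j => B ∈ Good r m K T (M * j)).card +
      ((Finset.range (n / M)).filter fun j => B ∉ Good r m K T (M * j)).card = n / M := by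
    rw [Finset.card_filter_add_card_filter_not, Finset.card_range]
  have hcnt := mul_card_le_cnt (D := ringSet F) (M := M) (N := M - 2 * r)
    (Q := fun j => j < n / M ∧ B ∈ Good r m K T (M * j)) (fun j hj => by
      calc M - 2 * r = cnt (ringSet F) (M * j + r) (M * j + M - r) := by
            rw [cnt_of_subset fun i hi hi' => hfull j hj.1 hj.2 i hi (by omega)]
            omega
        _ ≤ _ := cnt_mono _ (by omega) (by rw [Nat.mul_succ]; omega)) (n / M)
  have hfilter : ((Finset.range (n / M)).filter fun j => j < n / M ∧ B ∈ Good r m K T (M * j)) =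
      (Finset.range (n / M)).filter fun j => B ∈ Good r m K T (M * j) := by
    ext j
    simp only [Finset.mem_filter, Finset.mem_range]
    tauto
  rw [hfilter] at hcnt
  have hpos : 0 < ((Finset.range (n / M)).filter fun j => B ∈ Good r m K T (M * j)).card := by
    omega
  have hhub : none ∈ F := by
    refine none_mem_of_le_cnt hF ?_
    have h1 := cnt_mono (ringSet F) (a := 0) (b := M * (n / M)) (c := 0) (d := n) le_rfl hkM
    generalize cnt (ringSet F) 0 n = u at *
    generalize cnt (ringSet F) 0 (M * (n / M)) = v at *
    generalize ((Finset.range (n / M)).filter fun j => B ∈ Good r m K T (M * j)).card = g at *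
    generalize n / M = k at *
    have h2 : 3 * k ≤ 4 * g := by omega
    have h3 : 7 * M ≤ 8 * (M - 2 * r) := by omega
    have h4 : 7 * M * (3 * k) ≤ 8 * (M - 2 * r) * (4 * g) := Nat.mul_le_mul h3 h2
    have h5 : 8 * (M - 2 * r) * (4 * g) = 32 * ((M - 2 * r) * g) := by ring
    have h6 : 7 * M * (3 * k) = 21 * (M * k) := by ring
    omega
  obtain ⟨j, hj⟩ := Finset.card_pos.1 hpos
  simp only [Finset.mem_filter, Finset.mem_range] at hj
  have hjn : M * j + M ≤ n := (Nat.mul_le_mul_left M hj.1).trans hkM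
  have hrun : ∀ i, M * j + r ≤ i → i < M * j + r + r → i ∈ ringSet F :=
    fun i hi hi' => hfull j hj.1 hj.2 i hi (by omega)
  have hright : ∀ i, M * j + r ≤ i → i < n → i ∈ ringSet F := by
    refine forall_mem_of_run_right hrun fun i h1 h2 h3 => mem_ringSet_of_le_cnt hF hhub h2 ?_
    calc r = cnt (ringSet F) (i - r) i := by rw [cnt_of_subset h3]; omega
      _ ≤ _ := cnt_mono _ le_rfl (by omega)
  have hleft : ∀ i, 0 ≤ i → i < M * j + r + r → i ∈ ringSet F := by
    refine forall_mem_of_run_left hrun fun i _ h2 h3 =>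
      mem_ringSet_of_le_cnt hF hhub (by omega) ?_
    calc r = cnt (ringSet F) (i + 1) (i + r + 1) := by
          rw [cnt_of_subset fun j hj hj' => h3 j (by omega) (by omega)]; omega
      _ ≤ _ := cnt_mono _ (by omega) le_rfl
  refine Set.eq_univ_of_forall ?_
  rintro (_ | i)
  · exact hhub
  · rw [← vert_val]
    rcases lt_or_ge (i : ℕ) (M * j + r) with h | h
    · exact (hleft i (Nat.zero_le _) (by omega)).2
    · exact (hright i h i.2).2

/-- If independent events have probability at most `1/256`, at least a quarter of `k` of them occur
with probability at most `2⁻ᵏ`. -/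
theorem real_quarter_le {p : unitInterval} {E : ℕ → Set (Set ℕ)} {S : ℕ → Finset ℕ} {k : ℕ}
    (hE : ∀ j, DeterminedOn (E j) (S j)) (hS : ∀ J : Set ℕ, J.PairwiseDisjoint S)
    (hp : ∀ j, (bern p).real (E j) ≤ 1 / 256) {F : Set (Set ℕ)}
    (hF : ∀ B ∈ F, ∃ J ⊆ Finset.range k, k ≤ 4 * J.card ∧ ∀ j ∈ J, B ∈ E j) :
    (bern p).real F ≤ (1 / 2) ^ k := by
  classical
  have hsub : F ⊆ ⋃ J ∈ (Finset.range k).powerset.filter (fun J => k ≤ 4 * J.card),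
      ⋂ j ∈ J, E j := by
    intro B hB
    obtain ⟨J, hJ, hk, h⟩ := hF B hB
    simp only [Set.mem_iUnion, Set.mem_iInter]
    exact ⟨J, by simp [hJ, hk], h⟩
  refine (measureReal_mono hsub (measure_ne_top _ _)).trans
    ((measureReal_biUnion_finset_le _ _).trans ?_)
  refine (Finset.sum_le_card_nsmul _ _ ((1 / 4 : ℝ) ^ k) fun J hJ => ?_).trans ?_
  · rw [Finset.mem_filter] at hJ
    rw [real_biInter_eq_prod J (fun j _ => hE j) (hS _)]
    calc ∏ j ∈ J, (bern p).real (E j) ≤ ∏ _j ∈ J, (1 / 256 : ℝ) :=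
          Finset.prod_le_prod (fun _ _ => measureReal_nonneg) fun j _ => hp j
      _ = (1 / 4 : ℝ) ^ (4 * J.card) := by
          rw [Finset.prod_const, pow_mul]
          norm_num
      _ ≤ _ := pow_le_pow_of_le_one (by norm_num) (by norm_num) hJ.2
  · have hc : ((Finset.range k).powerset.filter (fun J => k ≤ 4 * J.card)).card ≤ 2 ^ k := by
      refine (Finset.card_filter_le _ _).trans ?_
      rw [Finset.card_powerset, Finset.card_range]
    rw [nsmul_eq_mul]
    calc _ ≤ ((2 ^ k : ℕ) : ℝ) * (1 / 4 : ℝ) ^ k := by gcongr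
      _ = (1 / 2 : ℝ) ^ k := by
        push_cast
        rw [← mul_pow]
        norm_num

theorem tendsto_percolationProb_wheel {p : unitInterval} {r m K T : ℕ} (hm : 3 ≤ m)
    (hr : 4 * m * (m + 1) + m ≤ r) (hK : 2 * r + 1 ≤ 2 * m * K) (hMr : 16 * r ≤ 2 * m * K * T)
    (hp : ∀ s, (bern p).real (Good r m K T s)ᶜ ≤ 1 / 256) :
    Tendsto (fun n => percolationProb (wheel n r) p) atTop (nhds 1) := by
  classical
  set M := 2 * m * K * T with hM
  have hlow : ∀ᶠ n in atTop,
      ENNReal.ofReal (1 - (1 / 2 : ℝ) ^ (n / M)) ≤ percolationProb (wheel n r) p := by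
    filter_upwards [eventually_ge_atTop (16 * M)] with n hn
    rw [percolationProb_eq]
    refine ENNReal.ofReal_le_of_le_toReal ?_
    rw [← measureReal_def]
    have hcompl := probReal_compl_eq_one_sub (μ := bern p) (measurableSet_percolates (wheel n r))
    have hle : (bern p).real {B | Percolates (wheel n r) (code n ⁻¹' B)}ᶜ ≤ (1 / 2) ^ (n / M) := by
      refine real_quarter_le (E := fun j => (Good r m K T (M * j))ᶜ)
        (S := fun j => Finset.Ico (0 + M * j) (0 + M * (j + 1))) (fun j => ?_)
        (fun J => pairwiseDisjoint_blocks J 0 M) (fun j => hp _) fun B hB => ?_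
      · have := (determinedOn_good r m K T (M * j)).compl
        rwa [zero_add, zero_add, Nat.mul_succ]
      · refine ⟨(Finset.range (n / M)).filter fun j => B ∉ Good r m K T (M * j),
          Finset.filter_subset _ _, ?_, fun j hj => (Finset.mem_filter.1 hj).2⟩
        by_contra hlt
        exact hB (percolates_of_good hM hm hr hK hMr hn (not_le.1 hlt))
    linarith
  have hlim : Tendsto (fun n => ENNReal.ofReal (1 - (1 / 2 : ℝ) ^ (n / M))) atTop (nhds 1) := by
    have h1 : Tendsto (fun k : ℕ => (1 - (1 / 2 : ℝ) ^ k)) atTop (nhds (1 - 0)) :=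
      (tendsto_pow_atTop_nhds_zero_of_lt_one (by norm_num) (by norm_num)).const_sub 1
    have h2 := ENNReal.tendsto_ofReal
      (h1.comp (Nat.tendsto_div_const_atTop (show M ≠ 0 by omega)))
    simpa using h2
  exact tendsto_of_tendsto_of_tendsto_of_le_of_le' hlim tendsto_const_nhds hlow
    (Eventually.of_forall fun n => by rw [percolationProb_eq]; exact prob_le_one)

theorem one_sub_pow_le_exp {s x : ℝ} {T : ℕ} (hs : 0 < s) (hs1 : s ≤ 1) (hT : x / s ≤ T) :
    (1 - s) ^ T ≤ Real.exp (-x) := by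
  have h1 : 1 - s ≤ Real.exp (-s) := Real.one_sub_le_exp_neg s
  calc (1 - s) ^ T ≤ Real.exp (-s) ^ T := pow_le_pow_left₀ (by linarith) h1 T
    _ = Real.exp (T * -s) := by rw [← Real.exp_nat_mul]
    _ ≤ Real.exp (-x) := by
      rw [div_le_iff₀ hs] at hT
      exact Real.exp_le_exp.2 (by linarith)

theorem eventually_exp_neg_le {ε : ℝ} (hε : 0 < ε) : ∀ᶠ r : ℕ in atTop, Real.exp (-(r : ℝ)) ≤ ε :=
  ((Real.tendsto_exp_neg_atTop_nhds_zero.comp tendsto_natCast_atTop_atTop).eventually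
    (eventually_le_nhds hε))

theorem eventually_mul_sq_mul_pow_le {ρ : ℝ} (h0 : 0 ≤ ρ) (h1 : ρ < 1) (C : ℝ) {ε : ℝ}
    (hε : 0 < ε) : ∀ᶠ r : ℕ in atTop, C * ((r : ℝ) ^ 2 * ρ ^ r) ≤ ε := by
  have h := (tendsto_pow_const_mul_const_pow_of_abs_lt_one 2
    (by rwa [abs_of_nonneg h0])).const_mul C
  rw [mul_zero] at h
  exact h.eventually (eventually_le_nhds hε)

theorem four_pow_le_choose {m : ℕ} (hm : 0 < m) :
    (4 : ℝ) ^ m ≤ 2 * (m + 1) * ((2 * m).choose (m + 1) : ℝ) := by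
  have h1 := Nat.four_pow_le_two_mul_self_mul_centralBinom m hm
  have h2 := Nat.choose_succ_right_eq (2 * m) m
  rw [show 2 * m - m = m by omega] at h2
  have h3 : 4 ^ m ≤ 2 * (m + 1) * (2 * m).choose (m + 1) := by
    rw [Nat.centralBinom] at h1
    nlinarith
  exact_mod_cast h3

/-- The exponential rate of a majority in blocks of length `2m` comes arbitrarily close to
`4p(1-p)`. -/
theorem eventually_pow_le_majority {p σ : ℝ} (hp : 0 < p) (hp1 : p < 1) (hσ : 0 ≤ σ)
    (hσp : σ < 4 * p * (1 - p)) : ∀ᶠ m : ℕ in atTop,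
      σ ^ m ≤ ((2 * m).choose (m + 1) : ℝ) * (p ^ (m + 1) * (1 - p) ^ (m - 1)) := by
  have hq : 0 < 1 - p := by linarith
  have hτ : 0 < 4 * p * (1 - p) := by positivity
  have hlim : ∀ᶠ m : ℕ in atTop, 4 * ((m : ℝ) ^ 2 * (σ / (4 * p * (1 - p))) ^ m) ≤ p / (1 - p) :=
    eventually_mul_sq_mul_pow_le (by positivity) ((div_lt_one hτ).2 hσp) 4 (by positivity)
  filter_upwards [hlim, eventually_ge_atTop 1] with m hm hm1
  have hm1' : (1 : ℝ) ≤ m := by exact_mod_cast hm1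
  have h1 := four_pow_le_choose hm1
  have h2 : p ^ (m + 1) * (1 - p) ^ (m - 1) = (p * (1 - p)) ^ m * (p / (1 - p)) := by
    obtain ⟨k, rfl⟩ := Nat.exists_eq_add_of_le' hm1
    rw [Nat.add_sub_cancel, mul_pow]
    field_simp
    ring
  rw [h2]
  rw [div_pow] at hm
  have h3 : σ ^ m * (4 * (m : ℝ) ^ 2) ≤ (4 * p * (1 - p)) ^ m * (p / (1 - p)) := by
    have h4 : σ ^ m * (4 * (m : ℝ) ^ 2) =
        4 * ((m : ℝ) ^ 2 * (σ ^ m / (4 * p * (1 - p)) ^ m)) * (4 * p * (1 - p)) ^ m := by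
      field_simp
    rw [h4, mul_comm ((4 * p * (1 - p)) ^ m)]
    gcongr
  have h5 : 2 * ((m : ℝ) + 1) ≤ 4 * (m : ℝ) ^ 2 := by nlinarith
  have h6 : (4 * p * (1 - p)) ^ m = 4 ^ m * (p * (1 - p)) ^ m := by rw [← mul_pow]; ring
  have h7 : σ ^ m * (2 * ((m : ℝ) + 1)) ≤
      2 * (m + 1) * ((2 * m).choose (m + 1) : ℝ) * ((p * (1 - p)) ^ m * (p / (1 - p))) :=
    calc σ ^ m * (2 * ((m : ℝ) + 1)) ≤ σ ^ m * (4 * (m : ℝ) ^ 2) := by gcongr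
      _ ≤ 4 ^ m * ((p * (1 - p)) ^ m * (p / (1 - p))) := by rwa [h6, mul_assoc] at h3
      _ ≤ _ := by gcongr
  refine le_of_mul_le_mul_right ?_ (show (0 : ℝ) < 2 * ((m : ℝ) + 1) by positivity)
  linarith

theorem eventually_tendsto_percolationProb {p : unitInterval} (hp : 1 / 4 < (p : ℝ))
    (hp2 : (p : ℝ) < 1 / 2) :
    ∀ᶠ r : ℕ in atTop, Tendsto (fun n => percolationProb (wheel n r) p) atTop (nhds 1) := by
  have hq : (0 : ℝ) < 1 - p := by linarith
  obtain ⟨σ, hσ, hσ'⟩ : ∃ σ : ℝ, 1 - p < σ ∧ σ < 4 * p * (1 - p) :=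
    exists_between (by nlinarith)
  have hσ0 : 0 < σ := hq.trans hσ
  have hσ1 : σ ≤ 1 := by nlinarith [sq_nonneg (2 * (p : ℝ) - 1)]
  obtain ⟨m, hmaj, hm3⟩ := ((eventually_pow_le_majority (by linarith) (by linarith) hσ0.le
    hσ').and (eventually_ge_atTop 3)).exists
  have hP (a : ℕ) : σ ^ m ≤ (bern p).real {A | m + 1 ≤ cnt A a (a + 2 * m)} :=
    hmaj.trans (le_real_majority p m rfl)
  filter_upwards [eventually_ge_atTop (4 * m * (m + 1) + m), eventually_ge_atTop 8,
    eventually_exp_neg_le (show (0 : ℝ) < 1 / 512 by norm_num),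
    eventually_mul_sq_mul_pow_le (ρ := (1 - p) / σ) (by positivity) ((div_lt_one hσ0).2 hσ)
      (4 * (m + 1) / σ ^ m) (show (0 : ℝ) < 1 / 512 by norm_num)] with r hr hr8 hexp hpow
  set s := σ ^ (r + m) with hs
  have hs0 : 0 < s := by positivity
  have hs1 : s ≤ 1 := pow_le_one₀ hσ0.le hσ1
  have hr8' : (8 : ℝ) ≤ r := by exact_mod_cast hr8
  have hmK : m * (r / m + 1) ≤ r + m := by
    have := Nat.mul_div_le r m
    rw [mul_add, mul_one]
    omega
  have hmK' : r < m * (r / m + 1) := by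
    have := Nat.div_add_mod r m
    have := Nat.mod_lt r (show 0 < m by omega)
    rw [mul_add, mul_one]
    omega
  have hT := Nat.le_ceil ((r : ℝ) / s)
  have hT' := Nat.ceil_lt_add_one (show 0 ≤ (r : ℝ) / s by positivity)
  have hrs : (r : ℝ) ≤ r / s := le_div_self (by positivity) hs0 hs1
  set T := ⌈(r : ℝ) / s⌉₊
  set K := r / m + 1
  have hT8 : 8 ≤ T := by
    have : (8 : ℝ) ≤ T := by linarith
    exact_mod_cast this
  refine tendsto_percolationProb_wheel (K := K) (T := T) hm3 hr ?_ ?_ fun a => ?_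
  · rw [mul_assoc]
    omega
  · calc 16 * r = 2 * r * 8 := by ring
      _ ≤ 2 * (m * K) * T := by gcongr
      _ = 2 * m * K * T := by ring
  · refine (real_compl_good_le (pow_nonneg hσ0.le m) hP r K T a).trans ?_
    have h1 : (1 - (σ ^ m) ^ K) ^ T ≤ 1 / 512 := by
      have hK : s ≤ (σ ^ m) ^ K := by
        rw [← pow_mul]
        exact pow_le_pow_of_le_one hσ0.le hσ1 hmK
      have hK1 : (σ ^ m) ^ K ≤ 1 := pow_le_one₀ (by positivity) (pow_le_one₀ hσ0.le hσ1)
      calc (1 - (σ ^ m) ^ K) ^ T ≤ (1 - s) ^ T := by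
            apply pow_le_pow_left₀ <;> linarith
        _ ≤ Real.exp (-(r : ℝ)) := one_sub_pow_le_exp hs0 hs1 hT
        _ ≤ _ := hexp
    have h2 : ((2 * m * K * T : ℕ) : ℝ) * (1 - p : ℝ) ^ (r + 1) ≤ 1 / 512 := by
      refine le_trans ?_ hpow
      have h3 : ((m * K : ℕ) : ℝ) ≤ (m + 1) * r := by
        have : m * K ≤ (m + 1) * r := by nlinarith
        exact_mod_cast this
      have h4 : (T : ℝ) ≤ 2 * (r / s) := by linarith
      have h5 : (1 - p : ℝ) ^ (r + 1) ≤ (1 - p : ℝ) ^ r :=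
        pow_le_pow_of_le_one hq.le (by linarith) (Nat.le_succ r)
      calc ((2 * m * K * T : ℕ) : ℝ) * (1 - p : ℝ) ^ (r + 1)
          = 2 * ((m * K : ℕ) : ℝ) * T * (1 - p : ℝ) ^ (r + 1) := by push_cast; ring
        _ ≤ 2 * ((m + 1) * r) * (2 * (r / s)) * (1 - p : ℝ) ^ r := by gcongr
        _ = 4 * (m + 1) / σ ^ m * ((r : ℝ) ^ 2 * ((1 - p) / σ) ^ r) := by
          rw [hs, pow_add, div_pow]
          field_simp
          ring
    linarith

theorem eventually_criticalProb_le {p : ℝ} (hp : 1 / 4 < p) (hp2 : p < 1 / 2) :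
    ∀ᶠ r : ℕ in atTop, criticalProb (fun n => wheel n r) ≤ p := by
  have hpI : p ∈ unitInterval := ⟨by linarith, by linarith⟩
  filter_upwards [eventually_tendsto_percolationProb (p := ⟨p, hpI⟩) hp hp2] with r hr
  exact csInf_le ⟨0, fun x ⟨hx, _⟩ => hx.1⟩ ⟨hpI, hr.liminf_eq⟩

/-- The passive vertex `i` lies between two runs of `r + 1` passive vertices, and no vertex between
these runs sees more than `r` active vertices. -/
def Protected (n r : ℕ) (B : Set ℕ) (i : ℕ) : Prop :=
  i ∉ B ∧ ∃ a b, r ≤ a ∧ a ≤ b ∧ b + 2 * r < n ∧ a ≤ i ∧ i ≤ b + r ∧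
    (∀ j, a ≤ j → j ≤ a + r → j ∉ B) ∧ (∀ j, b ≤ j → j ≤ b + r → j ∉ B) ∧
    ∀ w, a ≤ w → w ≤ b + r → cnt B (w - r) (w + r + 1) ≤ r

theorem cnt_le_of_disjoint_run {Z : Set ℕ} {a i r : ℕ} (hra : r ≤ i) (hai : a ≤ i)
    (hia : i ≤ a + r) (h : ∀ j, a ≤ j → j ≤ a + r → j ∉ Z) :
    cnt Z (i - r) (i + r + 1) ≤ r := by
  rw [← cnt_add Z (b := a) (by omega) (by omega),
    ← cnt_add Z (a := a) (b := a + r + 1) (by omega) (by omega),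
    cnt_of_disjoint (a := a) fun j hj hj' => h j hj (by omega)]
  have h1 := cnt_le Z (i - r) a
  have h2 := cnt_le Z (a + r + 1) (i + r + 1)
  omega

theorem cnt_not_protected_le {n r : ℕ} {B : Set ℕ} {i : ℕ} (hi : Protected n r B i) :
    r ≤ i ∧ i + r < n ∧ cnt {j | ¬ Protected n r B j} (i - r) (i + r + 1) ≤ r := by
  obtain ⟨hiB, a, b, hra, hab, hbn, hai, hib, ha, hb, hw⟩ := hi
  have hprot (j : ℕ) (hj : a ≤ j) (hj' : j ≤ b + r) (hjB : j ∉ B) : Protected n r B j :=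
    ⟨hjB, a, b, hra, hab, hbn, hj, hj', ha, hb, hw⟩
  refine ⟨by omega, by omega, ?_⟩
  rcases le_or_gt i (a + r) with h | h
  · exact cnt_le_of_disjoint_run (by omega) hai h fun j hj hj' h =>
      h (hprot j hj (by omega) (ha j hj hj'))
  rcases le_or_gt b i with h' | h'
  · exact cnt_le_of_disjoint_run (by omega) h' hib fun j hj hj' h =>
      h (hprot j (by omega) hj' (hb j hj hj'))
  · refine le_trans (cnt_mono_set fun j hj hj' hjZ => ?_) (hw i hai hib)
    by_contra hjB
    exact hjZ (hprot j (by omega) (by omega) hjB)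

/-- No block of `r + 1` vertices is passive among `K` consecutive ones starting from `c`. -/
def NoPassiveBlock (r K c : ℕ) : Set (Set ℕ) :=
  ⋂ t ∈ Finset.range K,
    {A | ∀ j ∈ Finset.Ico (c + (r + 1) * t) (c + (r + 1) * (t + 1)), j ∉ A}ᶜ

theorem measurableSet_noPassiveBlock (r K c : ℕ) : MeasurableSet (NoPassiveBlock r K c) :=
  Finset.measurableSet_biInter _ fun _ _ => (determinedOn_passive _).measurableSet.compl

theorem real_noPassiveBlock (p : unitInterval) (r K c : ℕ) :
    (bern p).real (NoPassiveBlock r K c) = (1 - (1 - p : ℝ) ^ (r + 1)) ^ K := by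
  rw [NoPassiveBlock, real_biInter_eq_prod _ (fun t _ => (determinedOn_passive _).compl)
    (pairwiseDisjoint_blocks _ _ _), Finset.prod_congr rfl
      (g := fun _ => (1 - (1 - p : ℝ) ^ (r + 1))), Finset.prod_const, Finset.card_range]
  intro t _
  rw [probReal_compl_eq_one_sub (determinedOn_passive _).measurableSet, real_passive, Nat.card_Ico]
  congr 2
  rw [mul_add, mul_one]
  omega

/-- Witness for a vertex `i` not being protected, within distance `(r + 1) K + r` of `i`. -/
def Exposed (r K i : ℕ) : Set (Set ℕ) :=
  ({A | i ∈ A} ∪ (NoPassiveBlock r K (i - (r + 1) * K) ∪ NoPassiveBlock r K i)) ∪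
    ⋃ w ∈ Finset.Ico (i - (r + 1) * K) (i + (r + 1) * K), {A | r + 1 ≤ cnt A (w - r) (w + r + 1)}

theorem measurableSet_exposed (r K i : ℕ) : MeasurableSet (Exposed r K i) := by
  refine ((?_ : MeasurableSet _).union ((measurableSet_noPassiveBlock _ _ _).union
    (measurableSet_noPassiveBlock _ _ _))).union
    (Finset.measurableSet_biUnion _ fun w _ =>
      (determinedOn_cnt {k | r + 1 ≤ k} _ _).measurableSet)
  simpa using (determinedOn_mem_iff i True).measurableSet

theorem real_exposed_le {p : unitInterval} (hp : (p : ℝ) ≤ 1 / 2) {r K i : ℕ}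
    (hi : (r + 1) * K + r ≤ i) :
    (bern p).real (Exposed r K i) ≤ p + 2 * (1 - (1 - p : ℝ) ^ (r + 1)) ^ K +
      4 * ((r + 1) * K) * (4 * p * (1 - p) : ℝ) ^ r := by
  refine (measureReal_union_le _ _).trans (add_le_add ?_ ?_)
  · refine (measureReal_union_le _ _).trans (add_le_add (real_mem p i).le ?_)
    refine (measureReal_union_le _ _).trans ?_
    rw [real_noPassiveBlock, real_noPassiveBlock, two_mul]
  · refine (measureReal_biUnion_finset_le _ _).trans
      ((Finset.sum_le_card_nsmul _ _ (2 * (4 * p * (1 - p) : ℝ) ^ r) fun w hw => ?_).trans ?_)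
    · rw [Finset.mem_Ico] at hw
      exact real_majority_le hp r (by omega)
    · rw [Nat.card_Ico, nsmul_eq_mul,
        show i + (r + 1) * K - (i - (r + 1) * K) = 2 * ((r + 1) * K) by omega]
      push_cast
      exact le_of_eq (by ring)

theorem mem_exposed_of_not_protected {n r K i : ℕ} {B : Set ℕ} (hi : (r + 1) * K + r ≤ i)
    (hin : i + (r + 1) * K + r ≤ n) (h : ¬ Protected n r B i) : B ∈ Exposed r K i := by
  by_contra hcon
  simp only [Exposed, NoPassiveBlock, Set.mem_union, Set.mem_iUnion, Set.mem_iInter, not_or,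
    not_exists, not_forall, Set.mem_compl_iff, not_not] at hcon
  obtain ⟨⟨h1, ⟨t, ht, h2⟩, ⟨u, hu, h3⟩⟩, h4⟩ := hcon
  rw [Finset.mem_range] at ht hu
  have ht' : (r + 1) * t + (r + 1) ≤ (r + 1) * K := Nat.mul_le_mul_left _ ht
  have hu' : (r + 1) * u + (r + 1) ≤ (r + 1) * K := Nat.mul_le_mul_left _ hu
  refine h ⟨h1, i - (r + 1) * K + (r + 1) * t, i + (r + 1) * u, by omega, by omega, by omega,
    by omega, by omega, fun j hj hj' => h2 j ?_, fun j hj hj' => h3 j ?_, fun w hw hw' => ?_⟩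
  · rw [Finset.mem_Ico, mul_add, mul_one]
    omega
  · rw [Finset.mem_Ico, mul_add, mul_one]
    omega
  · have := h4 w (Finset.mem_Ico.2 ⟨by omega, by omega⟩)
    exact Nat.lt_succ_iff.1 (not_le.1 this)

theorem exists_exposed_of_percolates {n r K : ℕ} {B : Set ℕ}
    (h : Percolates (wheel n r) (code n ⁻¹' B)) (hn : n ∉ B) :
    ∃ I ⊆ Finset.Ico ((r + 1) * K + r) (n - ((r + 1) * K + r)),
      n / 2 + 1 - 2 * ((r + 1) * K + r) ≤ I.card ∧ ∀ i ∈ I, B ∈ Exposed r K i := by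
  classical
  set L := (r + 1) * K + r with hL
  set Z : Set ℕ := {j | ¬ Protected n r B j} with hZ
  have hcnt : n / 2 + 1 ≤ cnt Z 0 n := by
    by_contra hlt
    refine not_percolates_of_confined (Z := Z) hn ?_ (by omega) ?_ h
    · rintro i ⟨hi, hiB⟩ hprot
      refine hprot.1 ?_
      have : code n (vert n i) ∈ B := hiB
      rwa [code_vert hi] at this
    · intro i _ hiZ
      exact cnt_not_protected_le (not_not.1 hiZ)
  refine ⟨(Finset.Ico L (n - L)).filter (· ∈ Z), Finset.filter_subset _ _, ?_, fun i hi => ?_⟩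
  · refine le_of_le_of_eq (b := cnt Z L (n - L)) ?_ (by rw [cnt]; congr)
    rcases le_or_gt L (n - L) with hle | hlt
    · have h1 := cnt_add Z (a := 0) (b := L) (c := n) (by omega) (by omega)
      have h2 := cnt_add Z (a := L) (b := n - L) (c := n) hle (by omega)
      have h3 := cnt_le Z 0 L
      have h4 := cnt_le Z (n - L) n
      omega
    · omega
  · simp only [Finset.mem_filter, Finset.mem_Ico] at hi
    exact mem_exposed_of_not_protected (by omega) (by omega) hi.2

theorem real_percolates_le {p : unitInterval} (hp : (p : ℝ) ≤ 1 / 4) {r K n : ℕ}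
    (hε : (p : ℝ) + 2 * (1 - (1 - p : ℝ) ^ (r + 1)) ^ K +
      4 * ((r + 1) * K) * (4 * p * (1 - p) : ℝ) ^ r ≤ 5 / 16)
    (hn : 64 * ((r + 1) * K + r) ≤ n) :
    (bern p).real {B | Percolates (wheel n r) (code n ⁻¹' B)} ≤ 11 / 12 := by
  set L := (r + 1) * K + r with hL
  let F : Set (Set ℕ) := {B | Percolates (wheel n r) (code n ⁻¹' B) ∧ n ∉ B}
  have hsub : {B | Percolates (wheel n r) (code n ⁻¹' B)} ⊆ {B | n ∈ B} ∪ F := by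
    intro B hB
    by_cases h : n ∈ B
    · exact Or.inl h
    · exact Or.inr ⟨hB, h⟩
  have hmarkov := mul_real_card_le_sum (bern p) (Finset.Ico L (n - L)) (E := Exposed r K)
    (fun j _ => measurableSet_exposed r K j) (n / 2 + 1 - 2 * L) (F := F)
    fun B hB => exists_exposed_of_percolates hB.1 hB.2
  have hsum : ∑ j ∈ Finset.Ico L (n - L), (bern p).real (Exposed r K j) ≤ n * (5 / 16) := by
    refine (Finset.sum_le_card_nsmul _ _ (5 / 16) fun j hj => ?_).trans ?_
    · exact (real_exposed_le (by linarith) (Finset.mem_Ico.1 hj).1).trans hε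
    · rw [nsmul_eq_mul]
      gcongr
      rw [Nat.card_Ico]
      omega
  have hk : (15 / 32 : ℝ) * (n + 1) ≤ ((n / 2 + 1 - 2 * L : ℕ) : ℝ) := by
    have : 15 * (n + 1) ≤ 32 * (n / 2 + 1 - 2 * L) := by omega
    have : (15 : ℝ) * (n + 1) ≤ 32 * ((n / 2 + 1 - 2 * L : ℕ) : ℝ) := by exact_mod_cast this
    linarith
  have hF : (bern p).real F ≤ 2 / 3 := by
    have h0 : 0 ≤ (bern p).real F := measureReal_nonneg
    have h1 : (15 / 32 : ℝ) * (n + 1) * (bern p).real F ≤ (n + 1) * (5 / 16) := by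
      have := mul_le_mul_of_nonneg_right hk h0
      linarith
    have h2 : (0 : ℝ) < n + 1 := by positivity
    refine le_of_mul_le_mul_left ?_ h2
    linarith
  calc _ ≤ (bern p).real ({B | n ∈ B} ∪ F) := measureReal_mono hsub
    _ ≤ (bern p).real {B | n ∈ B} + (bern p).real F := measureReal_union_le _ _
    _ ≤ 1 / 4 + 2 / 3 := add_le_add ((real_mem p n).le.trans hp) hF
    _ = 11 / 12 := by norm_num

theorem percolationProb_one {V : Type*} [Fintype V] (G : SimpleGraph V) :
    percolationProb G 1 = 1 := by
  rw [percolationProb, setBernoulli_one, Measure.dirac_apply_of_mem]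
  exact ⟨0, rfl⟩

theorem eventually_le_criticalProb {q : ℝ} (hq0 : 0 < q) (hq : q < 1 / 4) :
    ∀ᶠ r : ℕ in atTop, q ≤ criticalProb (fun n => wheel n r) := by
  have hq1 : 0 < 1 - q := by linarith
  filter_upwards [eventually_ge_atTop 1,
    eventually_exp_neg_le (show (0 : ℝ) < 1 / 64 by norm_num),
    eventually_mul_sq_mul_pow_le (ρ := 4 * q) (by positivity) (by linarith)
      (16 / (1 - q)) (show (0 : ℝ) < 1 / 32 by norm_num)] with r hr1 hexp hpow
  refine le_csInf ⟨1, ⟨⟨zero_le_one, le_rfl⟩, ?_⟩⟩ ?_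
  · have (n : ℕ) : percolationProb (wheel n r) ⟨1, zero_le_one, le_rfl⟩ = 1 :=
      percolationProb_one _
    simp only [this, liminf_const]
  rintro p ⟨hpI, hlim⟩
  by_contra! hpq
  have hr1' : (1 : ℝ) ≤ r := by exact_mod_cast hr1
  set s := (1 - q) ^ (r + 1) with hs
  have hs0 : 0 < s := by positivity
  have hs1 : s ≤ 1 := pow_le_one₀ hq1.le (by linarith)
  have hT := Nat.le_ceil ((r : ℝ) / s)
  have hT' := Nat.ceil_lt_add_one (show 0 ≤ (r : ℝ) / s by positivity)
  have hrs : (r : ℝ) ≤ r / s := le_div_self (by positivity) hs0 hs1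
  set K := ⌈(r : ℝ) / s⌉₊
  have hp0 : 0 ≤ p := hpI.1
  have hε : p + 2 * (1 - (1 - p) ^ (r + 1)) ^ K + 4 * ((r + 1) * K) * (4 * p * (1 - p)) ^ r
      ≤ 5 / 16 := by
    have h1 : (1 - (1 - p) ^ (r + 1)) ^ K ≤ 1 / 64 := by
      have hsp : s ≤ (1 - p) ^ (r + 1) := pow_le_pow_left₀ hq1.le (by linarith) _
      have hp1 : (1 - p) ^ (r + 1) ≤ 1 := pow_le_one₀ (by linarith) (by linarith)
      calc (1 - (1 - p) ^ (r + 1)) ^ K ≤ (1 - s) ^ K := by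
            apply pow_le_pow_left₀ <;> linarith
        _ ≤ Real.exp (-(r : ℝ)) := one_sub_pow_le_exp hs0 hs1 hT
        _ ≤ _ := hexp
    have h2 : 4 * (((r : ℝ) + 1) * K) * (4 * p * (1 - p)) ^ r ≤ 1 / 32 := by
      refine le_trans ?_ hpow
      have h3 : 4 * p * (1 - p) ≤ 4 * q * (1 - q) := by nlinarith
      have h4 : (K : ℝ) ≤ 2 * (r / s) := by linarith
      have h5 : 0 ≤ 4 * p * (1 - p) := by
        have : 0 ≤ 1 - p := by linarith
        positivity
      calc 4 * (((r : ℝ) + 1) * K) * (4 * p * (1 - p)) ^ r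
          ≤ 4 * ((r + r) * (2 * (r / s))) * (4 * q * (1 - q)) ^ r := by gcongr
        _ = 16 / (1 - q) * ((r : ℝ) ^ 2 * (4 * q) ^ r) := by
          rw [hs, pow_succ, mul_pow (4 * q)]
          field_simp
          ring
    linarith
  have hle : liminf (fun n => percolationProb (wheel n r) ⟨p, hpI⟩) atTop ≤
      ENNReal.ofReal (11 / 12) := by
    refine liminf_le_of_frequently_le' (Eventually.frequently ?_)
    filter_upwards [eventually_ge_atTop (64 * ((r + 1) * K + r))] with n hn
    rw [percolationProb_eq]
    refine (ENNReal.le_ofReal_iff_toReal_le (measure_ne_top _ _) (by norm_num)).2 ?_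
    exact real_percolates_le (p := ⟨p, hpI⟩) (by simp only; linarith) hε hn
  rw [hlim] at hle
  refine absurd hle (not_le.2 ?_)
  rw [ENNReal.ofReal_lt_one]
  norm_num

end StrictMBP

end

theorem theorem1 :
    Filter.Tendsto (fun r : ℕ => StrictMBP.criticalProb (fun n : ℕ => StrictMBP.wheel n r))
      Filter.atTop (nhds (1 / 4 : ℝ)) := by
  rw [tendsto_order]
  constructor
  · intro a ha
    obtain ⟨q, hq, hq'⟩ := exists_between (max_lt ha (show (0 : ℝ) < 1 / 4 by norm_num))
    filter_upwards [StrictMBP.eventually_le_criticalProb ((le_max_right _ _).trans_lt hq) hq']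
      with r hr
    exact (le_max_left _ _).trans_lt (hq.trans_le hr)
  · intro a ha
    obtain ⟨p, hp, hp'⟩ := exists_between (lt_min ha (show (1 / 4 : ℝ) < 1 / 2 by norm_num))
    filter_upwards [StrictMBP.eventually_criticalProb_le hp (hp'.trans_le (min_le_right _ _))]
      with r hr
    exact hr.trans_lt (hp'.trans_le (min_le_left _ _))
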